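/- \textbf{Setting.} Let $t=(t^{(i)}_k)_{1\le i\le 3,\,k\ge 1}$, put $\xi(t^{(i)},z)=\sum_{k\ge1}t^{(i)}_kz^k$, and let $t\pm[w]_i$ denote the times in which $t^{(i)}_k$ is replaced by $t^{(i)}_k\pm w^k/k$ for all $k\ge 1$. Let $e_1=(1,0)$, $e_2=(0,1)$, $e=(1,1)$, and let $n_1,n_2,n_3$ be non-negative integers. Let $(\tau_m)_{m\in\mathbb Z^2}$ be a tau function of the $[n_1,n_2,n_3]$-KdV hierarchy, that is, a family of nonzero formal power series $\tau_m(t)\in\mathbb C[[t]]$ such that for all integers $l\ge0$ and all $m,m'\in\mathbb Z^2$ \begin{align*} &\oint_{C_R}\frac{dz}{2\pi i}z^{n_1l+m_1-m_1'}e^{\xi(t^{(1)}-t'^{(1)},z)}\tau_m(t-[z^{-1}]_1)\tau_{m'}(t'+[z^{-1}]_1)\\ =&\oint_{C_r}\frac{dz}{2\pi i}z^{-n_2l+m_2-m_2'}e^{\xi(t^{(2)}-t'^{(2)},z^{-1})}\tau_{m+e}(t-[z]_2)\tau_{m'-e}(t'+[z]_2)\\ &+\oint_{C_r}\frac{dz}{2\pi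 i}(-1)^{m_2+m_2'}z^{-n_3l+m_1-m_2-m_1'+m_2'}e^{\xi(t^{(3)}-t'^{(3)},z^{-1})}\tau_{m+e_1}(t-[z]_3)\tau_{m'-e_1}(t'+[z]_3) \end{align*} in $\mathbb C[[t,t']]$, where each integral (over a large, respectively small, anticlockwise circle) is the coefficient of $z^{-1}$ in the formal expansion of the integrand. \textbf{Operators.} Let $\mathcal B$ be the ring of functions of $m\in\mathbb Z^2$ with values in the fraction field of $\mathbb C[[t]]$. Let $\Lambda_i$ be the shift $m\mapsto m+e_i$, so that $\Lambda_i f(m)=f(m+e_i)\Lambda_i$, and let $\Delta_2=\Lambda_2-1$, $\Delta_2^*=\Lambda_2^{-1}-1$. Let $\mathcal E=\mathcal B[\Lambda_1^{\pm1},\Lambda_2^{\pm1}]$ and, for $\alpha=1,2$, let $\mathcal E_{(\alpha)}^{0,\pm}=\mathcal B((\Lambda_\alpha^{\mp1}))$, and let $\mathcal E_{(\alpha)}^{\pm}\supseteq\mathcal E$ be the ring of finite sums $\sum_j a_j\Lambda_{3-\alpha}^j$ with $j\in\mathbb Z$ and $a_j\in\mathcal E_{(\alpha)}^{0,\pm}$.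 Put $$H=\Lambda_1\Delta_2+\rho,\qquad \rho(m)=\frac{\tau_m\,\tau_{m+e+e_1}}{\tau_{m+e_1}\,\tau_{m+e}}.$$ Define $S_1(\Lambda_1)=\sum_{k\ge0}a^{(1)}_k\Lambda_1^{-k}$, $S_2(\Lambda_2)=\sum_{k\ge0}a^{(2)}_k\Lambda_2^{k}$, $S_3(\Lambda_1)=\sum_{k\ge0}a^{(3)}_k\Lambda_1^{k}$ and $S_3(\Lambda_2^{-1})=\sum_{k\ge0}a^{(3)}_k\Lambda_2^{-k}$ by $$\sum_{k\ge0} a^{(1)}_k(m)z^{-k}=\frac{\tau_m(t-[z^{-1}]_1)}{\tau_m(t)},\quad \sum_{k\ge0} a^{(2)}_k(m)z^{k}=\frac{\tau_{m+e}(t-[z]_2)}{\tau_m(t)},\quad \sum_{k\ge0} a^{(3)}_k(m)z^{k}=(-1)^{m_2}\frac{\tau_{m+e_1}(t-[z]_3)}{\tau_m(t)},$$ and the Lax operators by \begin{align*} L_1&=S_1\Lambda_1S_1^{-1}, & L_3(\Lambda_1)&=S_3(\Lambda_1)\Lambda_1^{-1}S_3(\Lambda_1)^{-1},\\ L_2&=S_2\Lambda_2^{-1}S_2^{-1},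 & L_3(\Lambda_2^{-1})&=S_3(\Lambda_2^{-1})\Lambda_2S_3(\Lambda_2^{-1})^{-1}, \end{align*} with inverses taken in $\mathcal E_{(1)}^{0,+}$, $\mathcal E_{(1)}^{0,-}$, $\mathcal E_{(2)}^{0,-}$, $\mathcal E_{(2)}^{0,+}$ for $S_1$, $S_3(\Lambda_1)$, $S_2$, $S_3(\Lambda_2^{-1})$ respectively. Let \begin{align*} \mathcal L&=(L_1^{n_1})_{1,\ge0}+(L_2^{n_2})_{\Delta_2^*,\ge1}+\big(L_3(\Lambda_1)^{n_3}\big)_{1,<0},\\ \widetilde{\mathcal L}&=(L_1^{n_1})_{1,\ge0}+(L_2^{n_2})_{\Delta_2^*,\ge1}+\big(L_3(\Lambda_2^{-1})^{n_3}\big)_{\Delta_2,\ge1}. \end{align*} Here the index $1,\ge0$ (or $1,<0$) selects the terms of that order in $\Lambda_1$. For $D=\Delta_2$ (or $D=\Delta_2^*$), the index $D,\ge1$ selects the terms of order at least $1$ in $D$ after expanding $\Lambda_2^k=(D+1)^k$ (or $\Lambda_2^{-k}=(D+1)^k$) as $\sum_{j\ge0}\binom kjD^{k-j}$ for all $k\in\mathbb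 Z$. \textbf{Statement.} The direct sum decompositions $\mathcal E_{(\alpha)}^{\pm}=\mathcal E_{(\alpha)}^{0,\pm}\oplus\mathcal E_{(\alpha)}^{\pm}H$ hold for $\alpha=1,2$, and $\mathcal L,\widetilde{\mathcal L}\in\mathcal E$. If $\pi_\alpha^\pm:\mathcal E_{(\alpha)}^{\pm}\to\mathcal E_{(\alpha)}^{0,\pm}$ are the projections of these decompositions, then \begin{align*} \pi_1^+(\mathcal L)&=\pi_1^+(\widetilde{\mathcal L})=L_1^{n_1}, & \pi_1^-(\mathcal L)&=\pi_1^-(\widetilde{\mathcal L})=L_3(\Lambda_1)^{n_3},\\ \pi_2^+(\mathcal L)&=\pi_2^+(\widetilde{\mathcal L})=L_3(\Lambda_2^{-1})^{n_3}, & \pi_2^-(\mathcal L)&=\pi_2^-(\widetilde{\mathcal L})=L_2^{n_2}. \end{align*} -/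

import Mathlib

noncomputable section

namespace ThreeKP

/-! ### Formal difference operators in two shifts -/

/-- The lattice of discrete variables `m = (m₁, m₂)`; `m 0` is `m₁` and `m 1` is `m₂`. -/
abbrev ZLat : Type := Fin 2 → ℤ

/-- The standard basis vector `e₁` of the lattice. -/
def e₁ : ZLat := Pi.single 0 1

/-- The standard basis vector `e₂` of the lattice. -/
def e₂ : ZLat := Pi.single 1 1

/-- The vector `e = e₁ + e₂ = (1, 1)`. -/
def e₁₂ : ZLat := e₁ + e₂

/-- Formal operators `A = ∑_j a_j(m) Λ₁^{j₁} Λ₂^{j₂}`, recorded by their coefficients: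
`A j m` is `a_j(m)`. There is no restriction on the set of `j` that occur. -/
def FOp (K : Type) : Type := ZLat → ZLat → K

namespace FOp

variable {K : Type} [Field K]

instance : AddCommGroup (FOp K) := inferInstanceAs (AddCommGroup (ZLat → ZLat → K))

/-- The operator of multiplication by the function `f`. -/
def scalar (f : ZLat → K) : FOp K := fun j m => if j = 0 then f m else 0

/-- The monomial `Λ₁^{i₁} Λ₂^{i₂}`. -/
def shift (i : ZLat) : FOp K := fun j _ => if j = i then 1 else 0

instance : One (FOp K) := ⟨scalar 1⟩

/-- The product of operators, from `(a(m) Λ^i) (b(m) Λ^k) = a(m) b(m + i) Λ^{i + k}`. In every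
use below the sum has finitely many nonzero terms. -/
instance : Mul (FOp K) := ⟨fun A B j m => ∑ᶠ i : ZLat, A i m * B (j - i) (m + i)⟩

/-- Powers of an operator. -/
def pow (A : FOp K) : ℕ → FOp K
  | 0 => 1
  | n + 1 => pow A n * A

instance : Pow (FOp K) ℕ := ⟨pow⟩

end FOp

open FOp

section Spaces

variable (K : Type) [Field K]

/-- `𝓔 = 𝓑[Λ₁, Λ₁⁻¹, Λ₂, Λ₂⁻¹]`, the operators with finitely many terms. -/
def opE : Set (FOp K) := {A | {j | A j ≠ 0}.Finite}

/-- `𝓔_(α)^ε`. For `ε = 1` these are the operators whose order in `Λ_α` is bounded above, for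
`ε = -1` those whose order in `Λ_α` is bounded below; in both cases the exponents of the other
shift operator are bounded on both sides. The index `α = 0` stands for the first shift operator
and `α = 1` for the second. -/
def opEα (α : Fin 2) (ε : ℤˣ) : Set (FOp K) :=
  {A | ∃ N : ℤ, ∀ j : ZLat, (N < ε * j α ∨ ∃ β, β ≠ α ∧ N < |j β|) → A j = 0}

/-- `𝓔_(α)^{0,ε} = 𝓑((Λ_α^{-ε}))`, the operators of `𝓔_(α)^ε` in `Λ_α` alone. -/
def opEα0 (α : Fin 2) (ε : ℤˣ) : Set (FOp K) :=
  {A | A ∈ opEα K α ε ∧ ∀ j : ZLat, (∃ β, β ≠ α ∧ j β ≠ 0) → A j = 0}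

end Spaces

variable {K : Type} [Field K]

/-- The direct sum decomposition `𝓔_(α)^ε = 𝓔_(α)^{0,ε} ⊕ 𝓔_(α)^ε H`. -/
def DirectSumDecomposition (α : Fin 2) (ε : ℤˣ) (H : FOp K) : Prop :=
  (∀ P ∈ opEα0 K α ε, P ∈ opEα K α ε) ∧ (∀ Q ∈ opEα K α ε, Q * H ∈ opEα K α ε) ∧
    ∀ A ∈ opEα K α ε, ∃! P, P ∈ opEα0 K α ε ∧ ∃ Q ∈ opEα K α ε, A = P + Q * H

/-- The projection `π_α^ε` of `𝓔_(α)^ε` onto `𝓔_(α)^{0,ε}` along `𝓔_(α)^ε H`. -/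
def proj (α : Fin 2) (ε : ℤˣ) (H : FOp K) (A : FOp K) : FOp K :=
  Classical.epsilon fun P => P ∈ opEα0 K α ε ∧ ∃ Q ∈ opEα K α ε, A = P + Q * H

open Classical in
/-- The inverse of `S` in `C` (and `0` if there is none). -/
def invIn (C : Set (FOp K)) (S : FOp K) : FOp K :=
  if h : ∃ T ∈ C, S * T = 1 ∧ T * S = 1 then h.choose else 0

/-- The part `A_{1,≥0}` of nonnegative order in `Λ₁`. -/
def nonnegPart₁ (A : FOp K) : FOp K := fun j m => if 0 ≤ j 0 then A j m else 0

/-- The part `A_{1,<0}` of negative order in `Λ₁`. -/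
def negPart₁ (A : FOp K) : FOp K := fun j m => if j 0 < 0 then A j m else 0

/-- Let `A = ∑_k a_k (Λ₂^ε)^k` be an operator in `Λ₂` alone with `k` bounded above, and let
`D = Λ₂^ε - 1`, so that `D` is `Δ₂` for `ε = 1` and `Δ₂^*` for `ε = -1`. Expanding
`(Λ₂^ε)^k = (D + 1)^k = ∑_{l ≥ 0} (k choose l) D^{k-l}` for all integers `k` gives
`A = ∑_i c_i D^i` with `c_i = ∑_{l ≥ 0} (i+l choose l) a_{i+l}`. This is the part
`A_{D,≥1} = ∑_{i ≥ 1} c_i D^i`. -/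
def deltaPosPart (ε : ℤˣ) (A : FOp K) : FOp K :=
  ∑ᶠ i : ℕ,
    scalar (fun m => ∑ᶠ l : ℕ,
      (Nat.choose (i + 1 + l) l : K) * A (Pi.single 1 (ε * ((i + 1 + l : ℕ) : ℤ))) m) *
    (shift (Pi.single 1 (ε : ℤ)) - 1 : FOp K) ^ (i + 1)

/-! ### Tau functions -/

/-- The time variables: `(i, k)` is the index of `t^{(i+1)}_{k+1}`. -/
abbrev Time : Type := Fin 3 × ℕ

/-- Formal power series in the times `t`. -/
abbrev TSeries : Type := MvPowerSeries Time ℂ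

/-- Formal power series in two sets of times: `Sum.inl` marks `t`, `Sum.inr` marks `t'`. -/
abbrev TTSeries : Type := MvPowerSeries (Time ⊕ Time) ℂ

/-- Quotients of formal power series in the times. -/
abbrev TField : Type := FractionRing TSeries

/-- For `f(t)`, the power series in `w` given by `f(t + c [w]_i)`: every `t^{(i)}_k` is replaced
by `t^{(i)}_k + c w^k / k`, and the other times stay. The extra variable `none` is `w`. -/
def miwa (i : Fin 3) (c : ℂ) (f : TSeries) : PowerSeries TSeries :=
  MvPowerSeries.optionEquivLeft Time ℂ
    (MvPowerSeries.subst
      (fun s : Time =>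
        (MvPowerSeries.X (some s) +
          if s.1 = i then
            MvPowerSeries.C (c / ((s.2 : ℂ) + 1)) * MvPowerSeries.X none ^ (s.2 + 1)
          else 0 : MvPowerSeries (Option Time) ℂ))
      f)

/-- `f(t)` as a series in `t` and `t'`. -/
def inT (f : TSeries) : TTSeries :=
  MvPowerSeries.subst (fun s : Time => (MvPowerSeries.X (Sum.inl s) : TTSeries)) f

/-- `f(t')` as a series in `t` and `t'`. -/
def inT' (f : TSeries) : TTSeries :=
  MvPowerSeries.subst (fun s : Time => (MvPowerSeries.X (Sum.inr s) : TTSeries)) f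

/-- `ξ(t^{(i)} - t'^{(i)}, w) = ∑_{k ≥ 1} (t^{(i)}_k - t'^{(i)}_k) w^k`. -/
def xi (i : Fin 3) : PowerSeries TTSeries :=
  PowerSeries.mk fun k =>
    match k with
    | 0 => 0
    | k + 1 => MvPowerSeries.X (Sum.inl (i, k)) - MvPowerSeries.X (Sum.inr (i, k))

/-- `exp ξ(t^{(i)} - t'^{(i)}, w) = ∑_n ξ^n / n!`; only `n ≤ r` contributes to `w^r`. -/
def expXi (i : Fin 3) : PowerSeries TTSeries :=
  PowerSeries.mk fun r =>
    ∑ n ∈ Finset.range (r + 1), ((n.factorial : ℂ)⁻¹) • PowerSeries.coeff r (xi i ^ n)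

/-- The coefficient of `z^{-1}` in
`z^a exp(ξ(t^{(i)} - t'^{(i)}, z^s)) f(t - [z^{-s}]_i) g(t' + [z^{-s}]_i)`.
For `s = 1` it is the integral over a large circle and for `s = -1` the integral over a small
circle, with the measure `dz / (2πi)`. The terms with `z^{-1}` are indexed by the triples of
exponents `(r, p, q)` with `a + s (r - p - q) = -1`; each monomial in `t, t'` receives
contributions from finitely many of them. -/
def residue (i : Fin 3) (s : ℤˣ) (a : ℤ) (f g : TSeries) : TTSeries := fun d =>
  ∑ᶠ x : ℕ × ℕ × ℕ,
    if a + s * ((x.1 : ℤ) - x.2.1 - x.2.2) = -1 then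
      MvPowerSeries.coeff d
        (PowerSeries.coeff x.1 (expXi i) *
          inT (PowerSeries.coeff x.2.1 (miwa i (-1) f)) *
          inT' (PowerSeries.coeff x.2.2 (miwa i 1 g)))
    else 0

/-- The bilinear equations of the `[n₁, n₂, n₃]`-KdV hierarchy for the family `τ`, with
`n 0, n 1, n 2` standing for `n₁, n₂, n₃`. -/
def IsKdVTau (n : Fin 3 → ℕ) (τ : ZLat → TSeries) : Prop :=
  ∀ (l : ℕ) (m m' : ZLat),
    residue 0 1 (n 0 * l + m 0 - m' 0) (τ m) (τ m') =
      residue 1 (-1) (-(n 1 * l) + m 1 - m' 1) (τ (m + e₁₂)) (τ (m' - e₁₂)) +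
      ((-1 : ℂ) ^ (m 1 + m' 1)) •
        residue 2 (-1) (-(n 2 * l) + m 0 - m 1 - m' 0 + m' 1) (τ (m + e₁)) (τ (m' - e₁))

/-! ### Wave operators and Lax operators -/

section Lax

variable (τ : ZLat → TSeries)

/-- The coefficient of `w^k` in `f(t - [w]_i) / τ_m(t)`. -/
def waveCoeff (i : Fin 3) (f : TSeries) (m : ZLat) (k : ℕ) : TField :=
  algebraMap TSeries TField (PowerSeries.coeff k (miwa i (-1) f)) /
    algebraMap TSeries TField (τ m)

/-- `S₁(Λ₁) = ∑_k a_k(m) Λ₁^{-k}` with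
`∑_k a_k(m) z^{-k} = τ_m(t - [z⁻¹]_1) / τ_m(t)`. -/
def S₁ : FOp TField := fun j m =>
  if j 0 ≤ 0 ∧ j 1 = 0 then waveCoeff τ 0 (τ m) m (-j 0).toNat else 0

/-- `S₂(Λ₂) = ∑_k a_k(m) Λ₂^k` with `∑_k a_k(m) z^k = τ_{m+e}(t - [z]_2) / τ_m(t)`. -/
def S₂ : FOp TField := fun j m =>
  if j 0 = 0 ∧ 0 ≤ j 1 then waveCoeff τ 1 (τ (m + e₁₂)) m (j 1).toNat else 0

/-- The coefficients of
`∑_k a_k(m) z^k = (-1)^{m₂} τ_{m+e₁}(t - [z]_3) / τ_m(t)`. -/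
def s₃ (k : ℕ) (m : ZLat) : TField := (-1) ^ (m 1) * waveCoeff τ 2 (τ (m + e₁)) m k

/-- `S₃(Λ₁) = ∑_k a_k(m) Λ₁^k`, with the coefficients `s₃`. -/
def S₃ : FOp TField := fun j m => if 0 ≤ j 0 ∧ j 1 = 0 then s₃ τ (j 0).toNat m else 0

/-- `S₃(Λ₂⁻¹) = ∑_k a_k(m) Λ₂^{-k}`, with the coefficients `s₃`. -/
def S₃' : FOp TField := fun j m => if j 0 = 0 ∧ j 1 ≤ 0 then s₃ τ (-j 1).toNat m else 0

/-- `L₁(Λ₁) = S₁(Λ₁) Λ₁ S₁(Λ₁)⁻¹`, with the inverse in `𝓑((Λ₁⁻¹))`. -/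
def L₁ : FOp TField := S₁ τ * shift e₁ * invIn (opEα0 TField 0 1) (S₁ τ)

/-- `L₂(Λ₂) = S₂(Λ₂) Λ₂⁻¹ S₂(Λ₂)⁻¹`, with the inverse in `𝓑((Λ₂))`. -/
def L₂ : FOp TField := S₂ τ * shift (-e₂) * invIn (opEα0 TField 1 (-1)) (S₂ τ)

/-- `L₃(Λ₁) = S₃(Λ₁) Λ₁⁻¹ S₃(Λ₁)⁻¹`, with the inverse in `𝓑((Λ₁))`. -/
def L₃ : FOp TField := S₃ τ * shift (-e₁) * invIn (opEα0 TField 0 (-1)) (S₃ τ)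

/-- `L₃(Λ₂⁻¹) = S₃(Λ₂⁻¹) Λ₂ S₃(Λ₂⁻¹)⁻¹`, with the inverse in `𝓑((Λ₂⁻¹))`. -/
def L₃' : FOp TField := S₃' τ * shift e₂ * invIn (opEα0 TField 1 1) (S₃' τ)

/-- `B_k^{(1)}(Λ₁) = (L₁^k)_{1,≥0}`. -/
def B₁ (k : ℕ) : FOp TField := nonnegPart₁ (L₁ τ ^ k)

/-- `B_k^{(2)}(Λ₂) = (L₂^k)_{Δ₂^*,≥1}`. -/
def B₂ (k : ℕ) : FOp TField := deltaPosPart (-1) (L₂ τ ^ k)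

/-- `B_k^{(3)}(Λ₁) = (L₃(Λ₁)^k)_{1,<0}`. -/
def B₃ (k : ℕ) : FOp TField := negPart₁ (L₃ τ ^ k)

/-- `B_k^{(3)}(Λ₂⁻¹) = (L₃(Λ₂⁻¹)^k)_{Δ₂,≥1}`. -/
def B₃' (k : ℕ) : FOp TField := deltaPosPart 1 (L₃' τ ^ k)

/-- The Lax operator `𝓛`. -/
def laxOp (n : Fin 3 → ℕ) : FOp TField := B₁ τ (n 0) + B₂ τ (n 1) + B₃ τ (n 2)

/-- The Lax operator `𝓛̃`. -/
def laxOp' (n : Fin 3 → ℕ) : FOp TField := B₁ τ (n 0) + B₂ τ (n 1) + B₃' τ (n 2)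

/-- `ρ(m) = τ_m τ_{m+e+e₁} / (τ_{m+e₁} τ_{m+e})`. -/
def rho (m : ZLat) : TField :=
  algebraMap TSeries TField (τ m) / algebraMap TSeries TField (τ (m + e₁)) *
    (algebraMap TSeries TField (τ (m + e₁₂ + e₁)) / algebraMap TSeries TField (τ (m + e₁₂)))

/-- `H = Λ₁ Δ₂ + ρ`. -/
def H : FOp TField := shift e₁ * (shift e₂ - 1) + scalar (rho τ)

end Lax

end ThreeKP

end

open ThreeKP

noncomputable section
namespace ThreeKP

/-! ### The diagonal of a series in two sets of times -/

/-! Put `t' = t` and `m' = m + e₁ + j` in the bilinear equations and collect them over all `j` as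
coefficients of formal series in the monomials `Λ^j`. The equations for `l = 0` and `l = 1` become
`W₁ = W₂ + W₃` and `L₁^{n₁} W₁ = L₂^{n₂} W₂ + L₃^{n₃} W₃`. Each `W_i` equals `S_i K_i`, where a
shift acts on the kernel `K_i` only by moving its degree; therefore `L_i` raises the degree of `W_i`
by one (`exists_lax_eq`). Such series have weighted degree bounded below and form a module over the
matching ring `𝓔_(α)^±`. The series `W₃` lives over both `𝓔_(1)^-` and `𝓔_(2)^+`, so it serves both
forms of `L₃`.

The supports are `j 0 ≤ 0` for `W₁` (with all coefficients `1` on `j 0 = 0`), `1 ≤ j 1` for `W₂` and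
`j 1 ≤ j 0` for `W₃`. Moreover `K₁` is invariant under `Λ₂` and `K₂` under `Λ₁`, so a series `C W₁`
vanishes once its terms without `Λ₂` do, and a series `C W₂` once its terms without `Λ₁` do
(`smul_waveS_eq_zero`). Consequently, if `X₁ = X₂ + X₃` with `X_i = C_i W_i` supported in `j 0 < 0`,
`1 ≤ j 1`, `j 1 ≤ j 0` respectively, all three vanish: on `j 1 = 0` the supports are disjoint, so
`X₁ = 0`; then `X₂ = -X₃`, and these are disjoint on `j 0 = 0`. For `X_i = 𝓛 W_i - L_i^{n_i} W_i`
this is `mul_wave_eq`; the truncations in `𝓛` and `𝓛̃` are made to give these supports. A variant of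
the argument gives `H W_i = 0`.

Finally, `H` has degree one in either shift operator with invertible coefficients, so division by
`H` leaves a remainder in the other one (`exists_eq_add_mul`). The remainder is determined by its
action on `W_i`, since the part of `W_i` in that one operator is invertible. As `𝓛 W_i = L_i^{n_i}
W_i`, the remainder of `𝓛` is `L_i^{n_i}`. -/

theorem hasSubst_diag :
    MvPowerSeries.HasSubst (Sum.elim MvPowerSeries.X MvPowerSeries.X : Time ⊕ Time → TSeries) where
  const_coeff s := by rcases s with s | s <;> simp
  coeff_zero d := by
    have h : {s : Time | MvPowerSeries.coeff d (MvPowerSeries.X s : TSeries) ≠ 0}.Finite :=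
      MvPowerSeries.HasSubst.X.coeff_zero d
    refine ((h.image Sum.inl).union (h.image Sum.inr)).subset ?_
    rintro (s | s) hs
    · exact Or.inl ⟨s, hs, rfl⟩
    · exact Or.inr ⟨s, hs, rfl⟩

/-- The restriction to the diagonal `t' = t`. -/
def diag : TTSeries →ₐ[ℂ] TSeries := MvPowerSeries.substAlgHom hasSubst_diag

theorem hasSubst_inl :
    MvPowerSeries.HasSubst (fun s : Time => (MvPowerSeries.X (Sum.inl s) : TTSeries)) where
  const_coeff s := by simp
  coeff_zero d := (MvPowerSeries.HasSubst.X.coeff_zero d).preimage Sum.inl_injective.injOn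

theorem hasSubst_inr :
    MvPowerSeries.HasSubst (fun s : Time => (MvPowerSeries.X (Sum.inr s) : TTSeries)) where
  const_coeff s := by simp
  coeff_zero d := (MvPowerSeries.HasSubst.X.coeff_zero d).preimage Sum.inr_injective.injOn

theorem diag_X (s : Time ⊕ Time) :
    diag (MvPowerSeries.X s) = Sum.elim MvPowerSeries.X MvPowerSeries.X s := by
  rw [diag, MvPowerSeries.substAlgHom_apply, MvPowerSeries.subst_X hasSubst_diag]

theorem diag_inT (f : TSeries) : diag (inT f) = f := by
  rw [diag, MvPowerSeries.substAlgHom_apply, inT,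
    MvPowerSeries.subst_comp_subst_apply hasSubst_inl hasSubst_diag]
  simp only [MvPowerSeries.subst_X hasSubst_diag, Sum.elim_inl]
  exact congrFun MvPowerSeries.subst_self f

theorem diag_inT' (f : TSeries) : diag (inT' f) = f := by
  rw [diag, MvPowerSeries.substAlgHom_apply, inT',
    MvPowerSeries.subst_comp_subst_apply hasSubst_inr hasSubst_diag]
  simp only [MvPowerSeries.subst_X hasSubst_diag, Sum.elim_inr]
  exact congrFun MvPowerSeries.subst_self f

/-- The series `ξ` involves only differences `t - t'`, which die on the diagonal. -/
theorem diag_coeff_xi_pow (i : Fin 3) (r n : ℕ) :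
    diag (PowerSeries.coeff r (xi i ^ n)) = if r = 0 ∧ n = 0 then 1 else 0 := by
  have h : PowerSeries.map diag.toRingHom (xi i) = 0 := by
    ext1 k
    rw [PowerSeries.coeff_map, xi, PowerSeries.coeff_mk]
    rcases k with _ | k
    · simp
    · simp [diag_X]
  have h2 := PowerSeries.coeff_map diag.toRingHom r (xi i ^ n)
  rw [map_pow, h] at h2
  refine Eq.trans h2.symm ?_
  rcases n with _ | n
  · simp [PowerSeries.coeff_one]
  · simp

theorem diag_coeff_expXi (i : Fin 3) (r : ℕ) :
    diag (PowerSeries.coeff r (expXi i)) = if r = 0 then 1 else 0 := by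
  rw [expXi, PowerSeries.coeff_mk, map_sum]
  simp only [map_smul, diag_coeff_xi_pow]
  rcases r with _ | r
  · simp
  · simp

/-- The weight of `t_k` and of `t'_k` is `k`. -/
def timeWeight : Time ⊕ Time → ℕ := Sum.elim (fun s => s.2 + 1) (fun s => s.2 + 1)

/-- The weight of `t_k` is `k`. -/
def timeWeight₁ (s : Time) : ℕ := s.2 + 1

/-- The coefficient of `w^k` in `ξ` has weight `k`. This is what makes the sum in `residue` finite
in each weight. -/
theorem le_weightedOrder_coeff_xi_pow (i : Fin 3) (n r : ℕ) :
    (r : ℕ∞) ≤ (PowerSeries.coeff r (xi i ^ n)).weightedOrder timeWeight := by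
  induction n generalizing r with
  | zero =>
    rw [pow_zero, PowerSeries.coeff_one]
    split_ifs with h
    · simp [h]
    · simp
  | succ n ih =>
    rw [pow_succ, PowerSeries.coeff_mul]
    refine Finset.sum_induction _ (fun F : TTSeries => (r : ℕ∞) ≤ F.weightedOrder timeWeight)
      (fun a b ha hb => (le_min ha hb).trans (MvPowerSeries.min_weightedOrder_le_add _)) (by simp) ?_
    rintro ⟨p, q⟩ hpq
    rw [Finset.HasAntidiagonal.mem_antidiagonal] at hpq
    refine le_trans ?_ (MvPowerSeries.le_weightedOrder_mul timeWeight)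
    rw [← hpq, Nat.cast_add]
    refine add_le_add (ih p) ?_
    rw [xi, PowerSeries.coeff_mk]
    rcases q with _ | q
    · simp
    · refine MvPowerSeries.le_weightedOrder timeWeight fun d hd => ?_
      have key : ∀ s : Time ⊕ Time, timeWeight s = q + 1 →
          MvPowerSeries.coeff d (MvPowerSeries.X s : TTSeries) = 0 := by
        intro s hs
        rw [MvPowerSeries.coeff_X, if_neg]
        rintro rfl
        rw [Finsupp.weight_single, hs] at hd
        simp at hd
      rw [map_sub, key _ rfl, key _ rfl, sub_zero]

theorem le_weightedOrder_coeff_expXi (i : Fin 3) (r : ℕ) :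
    (r : ℕ∞) ≤ (PowerSeries.coeff r (expXi i)).weightedOrder timeWeight := by
  rw [expXi, PowerSeries.coeff_mk]
  refine Finset.sum_induction _ (fun F : TTSeries => (r : ℕ∞) ≤ F.weightedOrder timeWeight)
    (fun a b ha hb => (le_min ha hb).trans (MvPowerSeries.min_weightedOrder_le_add _)) (by simp)
    fun n _ => ?_
  refine MvPowerSeries.le_weightedOrder timeWeight fun d hd => ?_
  rw [MvPowerSeries.coeff_smul, MvPowerSeries.coeff_eq_zero_of_lt_weightedOrder timeWeight
    (hd.trans_le (le_weightedOrder_coeff_xi_pow i n r)), mul_zero]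

/-- Identifying `t'` with `t` preserves weights, so a coefficient of weight `W` on the diagonal
depends only on coefficients of weight at most `W`. -/
theorem weightedOrder_le_diag (F : TTSeries) :
    F.weightedOrder timeWeight ≤ (diag F).weightedOrder timeWeight₁ := by
  have hX0 (s : Time) : (MvPowerSeries.X s : TSeries) ≠ 0 := fun h => by
    have h2 := MvPowerSeries.coeff_index_single_self_X (R := ℂ) s
    rw [h, map_zero] at h2
    exact zero_ne_one h2
  have h := MvPowerSeries.le_weightedOrder_subst_of_forall_ne_zero timeWeight₁ hasSubst_diag
    (by rintro (s | s) <;> exact hX0 s) F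
  rw [diag, MvPowerSeries.substAlgHom_apply]
  have hX (s : Time) : (MvPowerSeries.X s : TSeries).weightedOrder timeWeight₁ = (s.2 + 1 : ℕ) := by
    rw [MvPowerSeries.X, MvPowerSeries.weightedOrder_monomial_of_ne_zero _ one_ne_zero,
      Finsupp.weight_single, smul_eq_mul, one_mul, timeWeight₁]
  have hw : ENat.toNat ∘ MvPowerSeries.weightedOrder timeWeight₁ ∘
      (Sum.elim MvPowerSeries.X MvPowerSeries.X : Time ⊕ Time → TSeries) = timeWeight := by
    funext s
    rcases s with s | s <;>
    · simp only [Function.comp_apply, Sum.elim_inl, Sum.elim_inr, hX, ENat.toNat_natCast, timeWeight]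
  rwa [hw] at h

/-- The sum of `u p * v q` over `p + q = N`. -/
def convol {R : Type*} [Semiring R] (u v : ℕ → R) (N : ℤ) : R :=
  if 0 ≤ N then ∑ x ∈ Finset.HasAntidiagonal.antidiagonal N.toNat, u x.1 * v x.2 else 0

/-- The residue is an infinite sum taken coefficientwise, so `diag` is not applied to it term by
term. Up to weight `W` it agrees with a finite sum, over the triples with `r ≤ W`; on the diagonal
the exponential is `1`, which leaves `r = 0` and `p + q = s (a + 1)`. -/
theorem diag_residue (i : Fin 3) (s : ℤˣ) (a : ℤ) (f g : TSeries) :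
    diag (residue i s a f g) =
      convol (fun p => PowerSeries.coeff p (miwa i (-1) f))
        (fun q => PowerSeries.coeff q (miwa i 1 g)) (s * (a + 1)) := by
  set N : ℤ := s * (a + 1) with hN
  set term : ℕ × ℕ × ℕ → TTSeries := fun x => PowerSeries.coeff x.1 (expXi i) *
    inT (PowerSeries.coeff x.2.1 (miwa i (-1) f)) *
    inT' (PowerSeries.coeff x.2.2 (miwa i 1 g)) with hterm
  have hcond (x : ℕ × ℕ × ℕ) :
      a + s * ((x.1 : ℤ) - x.2.1 - x.2.2) = -1 ↔ (x.2.1 : ℤ) + x.2.2 = x.1 + N := by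
    rcases Int.units_eq_one_or s with rfl | rfl <;> simp [hN] <;> omega
  ext e
  set W := Finsupp.weight timeWeight₁ e with hW
  -- From `p + q = r + N` and `r ≤ W` both `p` and `q` are at most `W + |N|`, so the box loses
  -- nothing.
  set T : Finset (ℕ × ℕ × ℕ) := ((Finset.range (W + 1)) ×ˢ
    (Finset.range (W + N.natAbs + 1)) ×ˢ (Finset.range (W + N.natAbs + 1))).filter
      fun x => (x.2.1 : ℤ) + x.2.2 = x.1 + N with hT
  have hmem (x : ℕ × ℕ × ℕ) : x ∈ T ↔ x.1 ≤ W ∧ (x.2.1 : ℤ) + x.2.2 = x.1 + N := by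
    simp only [hT, Finset.mem_filter, Finset.mem_product, Finset.mem_range]
    omega
  have hres (d) (hd : Finsupp.weight timeWeight d ≤ W) :
      MvPowerSeries.coeff d (residue i s a f g - ∑ x ∈ T, term x) = 0 := by
    rw [map_sub, sub_eq_zero]
    change ∑ᶠ x : ℕ × ℕ × ℕ, _ = _
    rw [finsum_eq_sum_of_support_subset (s := T), map_sum]
    · refine Finset.sum_congr rfl fun x hx => ?_
      rw [if_pos ((hcond x).2 ((hmem x).1 hx).2)]
    · intro x hx
      rw [Function.mem_support] at hx
      rw [Finset.mem_coe, hmem]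
      by_cases hc : a + s * ((x.1 : ℤ) - x.2.1 - x.2.2) = -1
      · refine ⟨?_, (hcond x).1 hc⟩
        by_contra! hlt
        apply hx
        rw [if_pos hc]
        apply MvPowerSeries.coeff_eq_zero_of_lt_weightedOrder timeWeight
        refine lt_of_lt_of_le ?_ (MvPowerSeries.le_weightedOrder_mul timeWeight)
        refine lt_of_lt_of_le ?_ le_self_add
        refine lt_of_lt_of_le ?_ (MvPowerSeries.le_weightedOrder_mul timeWeight)
        refine lt_of_lt_of_le ?_ le_self_add
        refine lt_of_lt_of_le ?_ (le_weightedOrder_coeff_expXi i x.1)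
        exact_mod_cast hd.trans_lt hlt
      · exact absurd (if_neg hc) hx
  have h0 : MvPowerSeries.coeff e (diag (residue i s a f g - ∑ x ∈ T, term x)) = 0 := by
    apply MvPowerSeries.coeff_eq_zero_of_lt_weightedOrder timeWeight₁
    refine lt_of_lt_of_le ?_ (weightedOrder_le_diag _)
    refine lt_of_lt_of_le ?_ (MvPowerSeries.le_weightedOrder timeWeight (n := ((W + 1 : ℕ) : ℕ∞)) ?_)
    · exact_mod_cast Nat.lt_succ_self W
    · intro d hd
      exact hres d (by exact_mod_cast Nat.lt_succ_iff.1 (by exact_mod_cast hd))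
  rw [map_sub, map_sub, sub_eq_zero] at h0
  rw [h0]
  congr 1
  have hd (x : ℕ × ℕ × ℕ) : diag (term x) = if x.1 = 0 then
      PowerSeries.coeff x.2.1 (miwa i (-1) f) * PowerSeries.coeff x.2.2 (miwa i 1 g) else 0 := by
    rw [hterm]
    simp only [map_mul, diag_inT, diag_inT', diag_coeff_expXi]
    split_ifs <;> simp
  rw [map_sum]
  simp only [hd]
  rw [← Finset.sum_filter, convol]
  split_ifs with hN0
  · refine Finset.sum_bij' (fun x _ => x.2) (fun y _ => (0, y)) ?_ ?_ ?_ ?_ ?_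
    · intro x hx
      simp only [Finset.mem_filter, hmem] at hx
      rw [Finset.HasAntidiagonal.mem_antidiagonal]
      omega
    · intro y hy
      rw [Finset.HasAntidiagonal.mem_antidiagonal] at hy
      simp only [Finset.mem_filter, hmem, Nat.cast_zero, and_true, zero_add]
      exact ⟨Nat.zero_le _, by omega⟩
    · rintro ⟨r, y⟩ hx
      simp only [Finset.mem_filter] at hx
      simp [hx.2]
    · intros; rfl
    · intros; rfl
  · refine Finset.sum_eq_zero fun x hx => ?_
    simp only [Finset.mem_filter, hmem] at hx
    omega

/-! ### Shifted times `t + c [w]_i` -/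

theorem hasSubst_miwa (i : Fin 3) (c : ℂ) :
    MvPowerSeries.HasSubst (fun s : Time =>
        (MvPowerSeries.X (some s) +
          if s.1 = i then
            MvPowerSeries.C (c / ((s.2 : ℂ) + 1)) * MvPowerSeries.X none ^ (s.2 + 1)
          else 0 : MvPowerSeries (Option Time) ℂ)) := by
  refine MvPowerSeries.HasSubst.add ⟨fun s => by simp, fun d =>
    (MvPowerSeries.HasSubst.X.coeff_zero d).preimage (Option.some_injective _).injOn⟩
    ⟨fun s => by split_ifs <;> simp, fun d => ?_⟩
  -- A given monomial `d` can be the power `w^(k+1)` only for `k = d none - 1`.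
  refine (Set.finite_singleton ((i, d none - 1) : Time)).subset fun s hs => ?_
  rw [Set.mem_ofPred_eq] at hs
  split_ifs at hs with h
  · rw [MvPowerSeries.coeff_C_mul, MvPowerSeries.X_pow_eq, MvPowerSeries.coeff_monomial] at hs
    split_ifs at hs with h2
    · rw [h2]
      simp [← h]
    · simp at hs
  · simp at hs

theorem coeff_zero_miwa (i : Fin 3) (c : ℂ) (f : TSeries) :
    PowerSeries.coeff 0 (miwa i c f) = f := by
  ext e
  have key (G : MvPowerSeries (Option Time) ℂ) : MvPowerSeries.coeff (e.optionElim 0) G =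
      MvPowerSeries.coeff e
        (PowerSeries.constantCoeff (MvPowerSeries.optionEquivLeft Time ℂ G)) := by
    rw [← PowerSeries.coeff_zero_eq_constantCoeff_apply,
      MvPowerSeries.coeff_coeff_optionEquivLeft]
  rw [miwa, MvPowerSeries.coeff_coeff_optionEquivLeft,
    MvPowerSeries.coeff_subst (hasSubst_miwa i c)]
  have hprod (d : Time →₀ ℕ) : MvPowerSeries.coeff (e.optionElim 0) (d.prod fun s k =>
      ((MvPowerSeries.X (some s) +
          if s.1 = i then
            MvPowerSeries.C (c / ((s.2 : ℂ) + 1)) * MvPowerSeries.X none ^ (s.2 + 1)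
          else 0 : MvPowerSeries (Option Time) ℂ)) ^ k) = if e = d then 1 else 0 := by
    rw [key, map_finsuppProd, map_finsuppProd]
    have h1 : (d.prod fun s k => PowerSeries.constantCoeff (MvPowerSeries.optionEquivLeft Time ℂ
        (((MvPowerSeries.X (some s) +
          if s.1 = i then
            MvPowerSeries.C (c / ((s.2 : ℂ) + 1)) * MvPowerSeries.X none ^ (s.2 + 1)
          else 0 : MvPowerSeries (Option Time) ℂ)) ^ k))) =
        d.prod fun s k => (MvPowerSeries.X s : TSeries) ^ k := by
      refine Finsupp.prod_congr fun s _ => ?_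
      rw [map_pow, map_pow, map_add, map_add, MvPowerSeries.optionEquivLeft_X_some]
      split_ifs <;> simp [MvPowerSeries.optionEquivLeft_X_none]
    rw [h1, ← MvPowerSeries.coeff_monomial, MvPowerSeries.monomial_one_eq]
  simp only [hprod]
  rw [finsum_eq_single _ e]
  · simp
  · intro d hd
    simp [Ne.symm hd]

end ThreeKP
end

noncomputable section
namespace ThreeKP

/-! ### The rings `𝓔_(α)^ε` and their modules of formal series -/

namespace FOp

variable {K : Type} [Field K]

theorem ext' {K : Type} {A B : FOp K} (h : ∀ j m, A j m = B j m) : A = B :=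
  funext fun j => funext (h j)

theorem add_apply (A B : FOp K) (j m : ZLat) : (A + B) j m = A j m + B j m := rfl

theorem sub_apply (A B : FOp K) (j m : ZLat) : (A - B) j m = A j m - B j m := rfl

theorem mul_apply (A B : FOp K) (j m : ZLat) :
    (A * B) j m = ∑ᶠ i : ZLat, A i m * B (j - i) (m + i) := rfl

theorem one_apply (j m : ZLat) : (1 : FOp K) j m = if j = 0 then 1 else 0 := rfl

theorem scalar_apply (f : ZLat → K) (j m : ZLat) : scalar f j m = if j = 0 then f m else 0 := rfl

theorem shift_apply (i j m : ZLat) : (shift i : FOp K) j m = if j = i then 1 else 0 := rfl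

theorem exists_of_mul_ne_zero {A B : FOp K} {j : ZLat} (h : (A * B) j ≠ 0) :
    ∃ i, A i ≠ 0 ∧ B (j - i) ≠ 0 := by
  by_contra! hc
  refine h (funext fun m => ?_)
  refine (finsum_congr fun i => ?_).trans finsum_zero
  by_cases hi : A i = 0
  · rw [hi, Pi.zero_apply, zero_mul]
  · rw [hc i hi, Pi.zero_apply, mul_zero]

theorem scalar_mul_apply (f : ZLat → K) (B : FOp K) (j m : ZLat) :
    (scalar f * B) j m = f m * B j m := by
  rw [mul_apply, finsum_eq_single _ 0]
  · simp [scalar_apply]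
  · intro i hi
    simp [scalar_apply, hi]

theorem shift_mul_apply (i : ZLat) (B : FOp K) (j m : ZLat) :
    (shift i * B : FOp K) j m = B (j - i) (m + i) := by
  rw [mul_apply, finsum_eq_single _ i]
  · simp [shift_apply]
  · intro k hk
    simp [shift_apply, hk]

theorem mul_shift_apply (A : FOp K) (i j m : ZLat) : (A * shift i : FOp K) j m = A (j - i) m := by
  rw [mul_apply, finsum_eq_single _ (j - i)]
  · simp [shift_apply]
  · intro k hk
    rw [shift_apply, if_neg, mul_zero]
    rintro rfl
    simp at hk

theorem one_mul' (A : FOp K) : 1 * A = A :=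
  ext' fun j m => (scalar_mul_apply 1 A j m).trans (by simp)

theorem shift_zero : (shift 0 : FOp K) = 1 := rfl

theorem mul_one' (A : FOp K) : A * 1 = A := by
  rw [← shift_zero]
  exact ext' fun j m => by rw [mul_shift_apply, sub_zero]

theorem zero_mul' (A : FOp K) : 0 * A = 0 :=
  ext' fun _ _ => (finsum_congr fun _ => zero_mul _).trans finsum_zero

theorem mul_zero' (A : FOp K) : A * 0 = 0 :=
  ext' fun _ _ => (finsum_congr fun _ => mul_zero _).trans finsum_zero

theorem shift_mul_shift (i j : ZLat) : (shift i * shift j : FOp K) = shift (i + j) :=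
  ext' fun k m => by simp only [shift_mul_apply, shift_apply, sub_eq_iff_eq_add, add_comm]

end FOp

open FOp

/-- The weighted degree on the lattice of exponents. -/
def deg (w : Fin 2 → ℤ) (j : ZLat) : ℤ := w 0 * j 0 + w 1 * j 1

theorem deg_sub (w : Fin 2 → ℤ) (i j : ZLat) : deg w (i - j) = deg w i - deg w j := by
  simp only [deg, Pi.sub_apply]; ring

variable {K : Type} [Field K] {α : Fin 2} {ε : ℤˣ} {w : Fin 2 → ℤ}

theorem mem_opEα_iff {A : FOp K} :
    A ∈ opEα K α ε ↔ ∃ N : ℤ, ∀ j, A j ≠ 0 → ε * j α ≤ N ∧ ∀ β, β ≠ α → |j β| ≤ N := by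
  refine exists_congr fun N => forall_congr' fun j => ?_
  rw [← not_imp_not]
  refine imp_congr_right fun _ => ?_
  push Not
  rfl

theorem add_mem_opEα {A B : FOp K} (hA : A ∈ opEα K α ε) (hB : B ∈ opEα K α ε) :
    A + B ∈ opEα K α ε := by
  obtain ⟨N, hN⟩ := mem_opEα_iff.1 hA
  obtain ⟨M, hM⟩ := mem_opEα_iff.1 hB
  refine mem_opEα_iff.2 ⟨max N M, fun j hj => ?_⟩
  by_cases h : A j = 0
  · obtain ⟨h1, h2⟩ := hM j fun h0 => hj (by change A j + B j = 0; rw [h, h0, add_zero])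
    exact ⟨h1.trans (le_max_right _ _), fun β hβ => (h2 β hβ).trans (le_max_right _ _)⟩
  · obtain ⟨h1, h2⟩ := hN j h
    exact ⟨h1.trans (le_max_left _ _), fun β hβ => (h2 β hβ).trans (le_max_left _ _)⟩

variable (K α ε) in
/-- The ring `𝓔_(α)^ε`. -/
def Rng : AddSubgroup (FOp K) where
  carrier := opEα K α ε
  add_mem' := add_mem_opEα
  zero_mem' := mem_opEα_iff.2 ⟨0, fun _ h => absurd rfl h⟩
  neg_mem' := fun {A} hA => by
    obtain ⟨N, hN⟩ := mem_opEα_iff.1 hA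
    exact mem_opEα_iff.2 ⟨N, fun j hj => hN j fun h0 => hj (by change -A j = 0; rw [h0, neg_zero])⟩

variable (K w) in
/-- The formal series whose weighted degree is bounded below. -/
def Ser : AddSubgroup (FOp K) where
  carrier := {A | ∃ N : ℤ, ∀ j, A j ≠ 0 → N ≤ deg w j}
  add_mem' := fun {A B} ⟨N, hN⟩ ⟨M, hM⟩ => by
    refine ⟨min N M, fun j hj => ?_⟩
    by_cases h : A j = 0
    · exact (min_le_right _ _).trans
        (hM j fun h0 => hj (by change A j + B j = 0; rw [h, h0, add_zero]))
    · exact (min_le_left _ _).trans (hN j h)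
  zero_mem' := ⟨0, fun _ h => absurd rfl h⟩
  neg_mem' := fun {A} ⟨N, hN⟩ =>
    ⟨N, fun j hj => hN j fun h0 => hj (by change -A j = 0; rw [h0, neg_zero])⟩

theorem finite_box (B : ℤ) : {j : ZLat | |j 0| ≤ B ∧ |j 1| ≤ B}.Finite := by
  refine (Set.finite_Icc (fun _ => -B : ZLat) (fun _ => B)).subset fun j hj => ?_
  simp only [Set.mem_ofPred_eq, abs_le] at hj
  constructor <;> intro i <;> fin_cases i <;> simp <;> omega

/-- Since `Λ_α` has weight `-ε`, an upper bound on the degree bounds `ε * i α` from below,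
complementing the bound from above in `𝓔_(α)^ε`. The finiteness of the products of ring elements
with series rests on this. -/
theorem abs_le_of_deg_le (hw : w α = -ε) {N M : ℤ} {i : ZLat} (h1 : ε * i α ≤ N)
    (h2 : ∀ β, β ≠ α → |i β| ≤ N) (h3 : deg w i ≤ M) :
    |i 0| ≤ |N| + |M| + (|w 0| + |w 1|) * |N| ∧ |i 1| ≤ |N| + |M| + (|w 0| + |w 1|) * |N| := by
  have hN := le_abs_self N
  have hM := le_abs_self M
  have hN0 := abs_nonneg N
  have hM0 := abs_nonneg M
  have key (β : Fin 2) (hβ : β ≠ α) : |w β * i β| ≤ |w β| * |N| := by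
    rw [abs_mul]
    exact mul_le_mul_of_nonneg_left ((h2 β hβ).trans hN) (abs_nonneg _)
  have hw0 := mul_nonneg (abs_nonneg (w 0)) hN0
  have hw1 := mul_nonneg (abs_nonneg (w 1)) hN0
  rw [add_mul]
  unfold deg at h3
  fin_cases α
  · have k1 := abs_le.1 (key 1 (by simp))
    have k2 := h2 1 (by simp)
    simp only [Fin.zero_eta] at hw h1
    rw [hw] at h3
    refine ⟨abs_le.2 ?_, by linarith⟩
    rcases Int.units_eq_one_or ε with rfl | rfl <;> simp at h1 h3 <;> constructor <;> linarith
  · have k1 := abs_le.1 (key 0 (by simp))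
    have k2 := h2 0 (by simp)
    simp only [Fin.mk_one] at hw h1
    rw [hw] at h3
    refine ⟨by linarith, abs_le.2 ?_⟩
    rcases Int.units_eq_one_or ε with rfl | rfl <;> simp at h1 h3 <;> constructor <;> linarith

theorem finite_mul_support (hw : w α = -ε) {A C : FOp K} (hA : A ∈ Rng K α ε) (hC : C ∈ Ser K w)
    (j : ZLat) : {i | A i ≠ 0 ∧ C (j - i) ≠ 0}.Finite := by
  obtain ⟨N, hN⟩ := mem_opEα_iff.1 hA
  obtain ⟨M, hM⟩ := hC
  refine (finite_box (|N| + |deg w j - M| + (|w 0| + |w 1|) * |N|)).subset fun i hi => ?_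
  have h := hM _ hi.2
  rw [deg_sub] at h
  exact abs_le_of_deg_le hw (hN i hi.1).1 (hN i hi.1).2 (by linarith)

theorem finite_support_mul (hw : w α = -ε) {A C : FOp K} (hA : A ∈ Rng K α ε) (hC : C ∈ Ser K w)
    (j m : ZLat) : Function.HasFiniteSupport fun i => A i m * C (j - i) (m + i) := by
  refine (finite_mul_support hw hA hC j).subset fun i hi => ⟨fun h => hi ?_, fun h => hi ?_⟩
  · simp [h]
  · simp [h]

theorem mul_mem_Rng {A B : FOp K} (hA : A ∈ Rng K α ε) (hB : B ∈ Rng K α ε) :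
    A * B ∈ Rng K α ε := by
  obtain ⟨N, hN⟩ := mem_opEα_iff.1 hA
  obtain ⟨M, hM⟩ := mem_opEα_iff.1 hB
  refine mem_opEα_iff.2 ⟨N + M, fun j hj => ?_⟩
  obtain ⟨i, hi, hji⟩ := exists_of_mul_ne_zero hj
  obtain ⟨h1, h2⟩ := hN i hi
  obtain ⟨h3, h4⟩ := hM _ hji
  constructor
  · rw [Pi.sub_apply] at h3
    linarith
  · intro β hβ
    have := abs_add_le (i β) ((j - i) β)
    rw [← Pi.add_apply, add_sub_cancel] at this
    linarith [h2 β hβ, h4 β hβ]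

theorem Rng_le_Ser (hw : w α = -ε) : Rng K α ε ≤ Ser K w := by
  intro A hA
  obtain ⟨N, hN⟩ := mem_opEα_iff.1 hA
  have key (β : Fin 2) (hβ : β ≠ α) (j : ZLat) (hj : A j ≠ 0) :
      -(|w β| * N) ≤ w β * j β := by
    have h := (hN j hj).2 β hβ
    have h2 : |w β * j β| ≤ |w β| * N := by
      rw [abs_mul]
      exact mul_le_mul_of_nonneg_left h (abs_nonneg _)
    exact (abs_le.1 h2).1
  fin_cases α
  · refine ⟨-N - |w 1| * N, fun j hj => ?_⟩
    have h1 := (hN j hj).1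
    have h2 := key 1 (by simp) j hj
    simp only [Fin.zero_eta] at hw h1
    rw [deg, hw]
    linarith
  · refine ⟨-N - |w 0| * N, fun j hj => ?_⟩
    have h1 := (hN j hj).1
    have h2 := key 0 (by simp) j hj
    simp only [Fin.mk_one] at hw h1
    rw [deg, hw]
    linarith

theorem mul_mem_Ser (hw : w α = -ε) {A C : FOp K} (hA : A ∈ Rng K α ε) (hC : C ∈ Ser K w) :
    A * C ∈ Ser K w := by
  obtain ⟨N, hN⟩ := Rng_le_Ser hw hA
  obtain ⟨M, hM⟩ := hC
  refine ⟨N + M, fun j hj => ?_⟩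
  obtain ⟨i, hi, hji⟩ := exists_of_mul_ne_zero hj
  have h1 := hN i hi
  have h2 := hM _ hji
  rw [deg_sub] at h2
  linarith

/-- Both sides are iterated finite sums of one triple product; the point is that its support in the
two free exponents is jointly finite. -/
theorem mul_assoc_of_mem (hw : w α = -ε) {A B C : FOp K} (hA : A ∈ Rng K α ε)
    (hB : B ∈ Rng K α ε) (hC : C ∈ Ser K w) : A * B * C = A * (B * C) := by
  refine ext' fun j m => ?_
  set f : ZLat × ZLat → K := fun x => A x.1 m * (B x.2 (m + x.1) *
    C (j - x.1 - x.2) (m + x.1 + x.2)) with hf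
  have hfin : Function.HasFiniteSupport f := by
    have hAfin := finite_mul_support hw hA (mul_mem_Ser hw hB hC) j
    obtain ⟨N, hN⟩ := mem_opEα_iff.1 hA
    obtain ⟨N', hN'⟩ := mem_opEα_iff.1 hB
    obtain ⟨M, hM⟩ := hC
    obtain ⟨D, hD⟩ := Rng_le_Ser hw hB
    obtain ⟨D', hD'⟩ := Rng_le_Ser hw hA
    refine ((finite_box (|N| + |deg w j - M - D| + (|w 0| + |w 1|) * |N|)).prod
      (finite_box (|N'| + |deg w j - M - D'| + (|w 0| + |w 1|) * |N'|))).subset ?_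
    rintro ⟨k, l⟩ hkl
    have h1 : A k ≠ 0 := fun h => hkl (by simp [hf, h])
    have h2 : B l ≠ 0 := fun h => hkl (by simp [hf, h])
    have h3 : C (j - k - l) ≠ 0 := fun h => hkl (by simp [hf, h])
    have h4 := hM _ h3
    rw [deg_sub, deg_sub] at h4
    have h5 := hD l h2
    have h6 := hD' k h1
    exact ⟨abs_le_of_deg_le hw (hN k h1).1 (hN k h1).2 (by linarith),
      abs_le_of_deg_le hw (hN' l h2).1 (hN' l h2).2 (by linarith)⟩
  have hR : (A * (B * C)) j m = ∑ᶠ x, f x := by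
    rw [finsum_curry f hfin, mul_apply]
    refine finsum_congr fun k => ?_
    rw [mul_apply, mul_finsum]
  -- In `(A * B) * C` the outer index is the exponent of `A * B`; subtracting that of `A` recovers
  -- the exponent of `B`.
  let e : ZLat × ZLat ≃ ZLat × ZLat :=
    { toFun := fun x => (x.2, x.1 - x.2)
      invFun := fun y => (y.1 + y.2, y.1)
      left_inv := fun x => by simp
      right_inv := fun y => by simp }
  have hL : (A * B * C) j m = ∑ᶠ x, f (e x) := by
    rw [finsum_curry (fun x => f (e x)) (hfin.preimage e.injective.injOn), mul_apply]
    refine finsum_congr fun i => ?_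
    rw [mul_apply, finsum_mul]
    refine finsum_congr fun k => ?_
    simp only [hf, e, Equiv.coe_fn_mk]
    rw [mul_assoc, show j - k - (i - k) = j - i by abel, show m + k + (i - k) = m + i by abel]
  rw [hL, hR, finsum_comp_equiv e]

theorem add_mul_of_mem (hw : w α = -ε) {A B C : FOp K} (hA : A ∈ Rng K α ε)
    (hB : B ∈ Rng K α ε) (hC : C ∈ Ser K w) : (A + B) * C = A * C + B * C := by
  refine ext' fun j m => ?_
  rw [FOp.add_apply, mul_apply, mul_apply, mul_apply, ← finsum_add_distrib
    (finite_support_mul hw hA hC j m) (finite_support_mul hw hB hC j m)]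
  exact finsum_congr fun i => by rw [FOp.add_apply, add_mul]

theorem mul_add_of_mem (hw : w α = -ε) {A C D : FOp K} (hA : A ∈ Rng K α ε)
    (hC : C ∈ Ser K w) (hD : D ∈ Ser K w) : A * (C + D) = A * C + A * D := by
  refine ext' fun j m => ?_
  rw [FOp.add_apply, mul_apply, mul_apply, mul_apply, ← finsum_add_distrib
    (finite_support_mul hw hA hC j m) (finite_support_mul hw hA hD j m)]
  exact finsum_congr fun i => by rw [FOp.add_apply, mul_add]

theorem one_mem_Rng : (1 : FOp K) ∈ Rng K α ε := by
  refine mem_opEα_iff.2 ⟨0, fun j hj => ?_⟩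
  have : j = 0 := by
    by_contra h
    exact hj (funext fun m => if_neg h)
  simp [this]

/-- A sample weight with `w α = -ε`. The ring embeds in the corresponding series space, so its
axioms are instances of the module laws. -/
theorem neg_single_apply_self (α : Fin 2) (ε : ℤˣ) :
    (Pi.single α (-(ε : ℤ)) : Fin 2 → ℤ) α = -ε := Pi.single_eq_same _ _

instance : Mul (Rng K α ε) := ⟨fun A B => ⟨A.1 * B.1, mul_mem_Rng A.2 B.2⟩⟩

instance : One (Rng K α ε) := ⟨⟨1, one_mem_Rng⟩⟩

instance : Ring (Rng K α ε) :=
  { (inferInstance : AddCommGroup (Rng K α ε)) with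
    mul_assoc := fun A B C => Subtype.ext (mul_assoc_of_mem (neg_single_apply_self α ε) A.2 B.2
      (Rng_le_Ser (neg_single_apply_self α ε) C.2))
    one_mul := fun A => Subtype.ext (one_mul' A.1)
    mul_one := fun A => Subtype.ext (mul_one' A.1)
    zero_mul := fun _ => Subtype.ext (zero_mul' _)
    mul_zero := fun _ => Subtype.ext (mul_zero' _)
    left_distrib := fun A B C => Subtype.ext (mul_add_of_mem (neg_single_apply_self α ε) A.2
      (Rng_le_Ser (neg_single_apply_self α ε) B.2) (Rng_le_Ser (neg_single_apply_self α ε) C.2))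
    right_distrib := fun A B C => Subtype.ext (add_mul_of_mem (neg_single_apply_self α ε) A.2 B.2
      (Rng_le_Ser (neg_single_apply_self α ε) C.2)) }

theorem coe_mul (A B : Rng K α ε) : ((A * B : Rng K α ε) : FOp K) = (A : FOp K) * B := rfl
theorem coe_one : ((1 : Rng K α ε) : FOp K) = 1 := rfl

theorem coe_sub (A B : Rng K α ε) : ((A - B : Rng K α ε) : FOp K) = (A : FOp K) - B := rfl

theorem coe_pow (A : Rng K α ε) (n : ℕ) : ((A ^ n : Rng K α ε) : FOp K) = (A : FOp K) ^ n := by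
  induction n with
  | zero => rw [pow_zero]; rfl
  | succ n ih => rw [pow_succ, coe_mul, ih]; rfl

/-- One weight may fit two rings: for `w = (1, -1)` both `𝓔_(1)^-` and `𝓔_(2)^+` act. -/
instance [hw : Fact (w α = -ε)] : Module (Rng K α ε) (Ser K w) where
  smul A C := ⟨A.1 * C.1, mul_mem_Ser hw.1 A.2 C.2⟩
  one_smul C := Subtype.ext (one_mul' C.1)
  mul_smul A B C := Subtype.ext (mul_assoc_of_mem hw.1 A.2 B.2 C.2)
  smul_zero _ := Subtype.ext (mul_zero' _)
  smul_add A C D := Subtype.ext (mul_add_of_mem hw.1 A.2 C.2 D.2)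
  add_smul A B C := Subtype.ext (add_mul_of_mem hw.1 A.2 B.2 C.2)
  zero_smul _ := Subtype.ext (zero_mul' _)

end ThreeKP
end

noncomputable section
namespace ThreeKP

open FOp

variable {K : Type} [Field K] {α : Fin 2} {ε : ℤˣ} {w : Fin 2 → ℤ}

theorem eq_zero_of_shift_apply_ne_zero {i j : ZLat} (h : (shift i : FOp K) j ≠ 0) : j = i := by
  by_contra hji
  exact h (funext fun m => if_neg hji)

theorem shift_mem_Rng (i : ZLat) : (shift i : FOp K) ∈ Rng K α ε := by
  refine mem_opEα_iff.2 ⟨|i 0| + |i 1|, fun j hj => ?_⟩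
  rw [eq_zero_of_shift_apply_ne_zero hj]
  have h (β : Fin 2) : |i β| ≤ |i 0| + |i 1| := by
    fin_cases β
    · exact le_add_of_nonneg_right (abs_nonneg _)
    · exact le_add_of_nonneg_left (abs_nonneg _)
  refine ⟨(le_abs_self _).trans ((le_of_eq ?_).trans (h α)), fun β _ => h β⟩
  rcases Int.units_eq_one_or ε with rfl | rfl <;> simp

variable (K α ε) in
/-- The monomials as elements of `𝓔_(α)^ε`. -/
def shiftR (i : ZLat) : Rng K α ε := ⟨shift i, shift_mem_Rng i⟩

theorem shiftR_mul (i j : ZLat) : shiftR K α ε i * shiftR K α ε j = shiftR K α ε (i + j) :=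
  Subtype.ext (shift_mul_shift i j)

theorem shiftR_zero : shiftR K α ε 0 = 1 := rfl

variable (K α ε) in
/-- The subring `𝓔_(α)^{0,ε}`. -/
def Rng0 : Subring (Rng K α ε) where
  carrier := {A | ∀ j, A.1 j ≠ 0 → ∀ β, β ≠ α → j β = 0}
  mul_mem' := fun {A B} hA hB j hj β hβ => by
    obtain ⟨i, hi, hji⟩ := exists_of_mul_ne_zero hj
    have h := hB _ hji β hβ
    rwa [Pi.sub_apply, hA i hi β hβ, sub_zero] at h
  one_mem' := fun j hj β _ => by
    rw [eq_zero_of_shift_apply_ne_zero (K := K) (i := 0) hj]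
    rfl
  add_mem' := fun {A B} hA hB j hj β hβ => by
    by_cases h : A.1 j = 0
    · exact hB j (fun h0 => hj (by change A.1 j + B.1 j = 0; rw [h, h0, add_zero])) β hβ
    · exact hA j h β hβ
  zero_mem' := fun _ h => absurd rfl h
  neg_mem' := fun {A} hA j hj β hβ =>
    hA j (fun h0 => hj (by change -A.1 j = 0; rw [h0, neg_zero])) β hβ

theorem mem_opEα0_iff {A : FOp K} :
    A ∈ opEα0 K α ε ↔ ∃ h : A ∈ Rng K α ε, (⟨A, h⟩ : Rng K α ε) ∈ Rng0 K α ε := by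
  have key : (∀ j : ZLat, (∃ β, β ≠ α ∧ j β ≠ 0) → A j = 0) ↔
      ∀ j, A j ≠ 0 → ∀ β, β ≠ α → j β = 0 := by
    refine forall_congr' fun j => ?_
    rw [← not_imp_not]
    refine imp_congr_right fun _ => ?_
    push Not
    rfl
  constructor
  · rintro ⟨h1, h2⟩
    exact ⟨h1, key.1 h2⟩
  · rintro ⟨h1, h2⟩
    exact ⟨h1, key.2 h2⟩

theorem coe_mem_opEα0 {A : Rng K α ε} (h : A ∈ Rng0 K α ε) : (A : FOp K) ∈ opEα0 K α ε :=
  mem_opEα0_iff.2 ⟨A.2, h⟩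

/-- Invertibility in `𝓔_(α)^{0,ε}`. -/
def HasInv0 (A : Rng K α ε) : Prop := ∃ G ∈ Rng0 K α ε, A * G = 1 ∧ G * A = 1

/-! ### Power series in one shift operator -/

/-- The exponent `-ε` of `Λ_α`, so that `𝓔_(α)^{0,ε}` consists of the Laurent series in
`Λ_α^{-ε}`. -/
def dir (α : Fin 2) (ε : ℤˣ) : ZLat := Pi.single α (-(ε : ℤ))

theorem zsmul_dir_self (c : ℤ) : (c • dir α ε) α = -(ε * c) := by
  simp [dir, mul_comm]

theorem dir_of_ne {β : Fin 2} (h : β ≠ α) : dir α ε β = 0 := by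
  simp [dir, h]

theorem unit_mul_self_mul (ε : ℤˣ) (c : ℤ) : (ε : ℤ) * (ε * c) = c := by
  rcases Int.units_eq_one_or ε with rfl | rfl <;> simp

theorem eq_zsmul_dir {j : ZLat} (h : ∀ β, β ≠ α → j β = 0) : j = (-(ε * j α)) • dir α ε := by
  funext β
  by_cases hβ : β = α
  · subst hβ
    rw [zsmul_dir_self, mul_neg, unit_mul_self_mul, neg_neg]
  · rw [h β hβ, Pi.smul_apply, dir_of_ne hβ, smul_zero]

variable (α ε) in
/-- The series `∑_k u_k Λ_α^{-εk}`. -/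
def ser (u : ℕ → ZLat → K) : FOp K := fun j m =>
  if 0 ≤ -(ε * j α) ∧ ∀ β, β ≠ α → j β = 0 then u (-(ε * j α)).toNat m else 0

theorem ser_zsmul (u : ℕ → ZLat → K) (c : ℤ) (m : ZLat) :
    ser α ε u (c • dir α ε) m = if 0 ≤ c then u c.toNat m else 0 := by
  have h : ∀ β, β ≠ α → (c • dir α ε) β = 0 := fun β hβ => by
    rw [Pi.smul_apply, dir_of_ne hβ, smul_zero]
  rw [ser, zsmul_dir_self, mul_neg, unit_mul_self_mul, neg_neg]
  exact if_congr (and_iff_left h) rfl rfl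

theorem ser_nsmul (u : ℕ → ZLat → K) (n : ℕ) (m : ZLat) :
    ser α ε u (n • dir α ε) m = u n m := by
  rw [← natCast_zsmul, ser_zsmul, if_pos (Int.natCast_nonneg n), Int.toNat_natCast]

theorem exists_of_ser_ne_zero {u : ℕ → ZLat → K} {j : ZLat} (h : ser α ε u j ≠ 0) :
    ∃ n : ℕ, j = n • dir α ε := by
  have h2 : 0 ≤ -(ε * j α) ∧ ∀ β, β ≠ α → j β = 0 := by
    by_contra hc
    exact h (funext fun m => if_neg hc)
  refine ⟨(-(ε * j α)).toNat, ?_⟩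
  rw [← natCast_zsmul, Int.toNat_of_nonneg h2.1]
  exact eq_zsmul_dir h2.2

theorem dir_ne_zero : dir α ε ≠ 0 := fun h => by
  have := congrFun h α
  simp [dir] at this

theorem nsmul_dir_injective : Function.Injective fun n : ℕ => n • dir α ε :=
  fun a b h => by
    have := congrFun h α
    simpa [dir] using this

theorem finsum_ser_mul (u : ℕ → ZLat → K) (m : ZLat) (f : ZLat → K) :
    ∑ᶠ i, ser α ε u i m * f i = ∑ᶠ k : ℕ, u k m * f (k • dir α ε) := by
  have h1 := finsum_mem_range (f := fun i => ser α ε u i m * f i)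
    (nsmul_dir_injective (α := α) (ε := ε))
  simp only [ser_nsmul] at h1
  rw [← h1]
  refine finsum_congr fun i => ?_
  by_cases hi : i ∈ Set.range fun n : ℕ => n • dir α ε
  · simp only [hi, finsum_true]
  · simp only [hi, finsum_false]
    have : ser α ε u i = 0 := by
      by_contra h
      obtain ⟨n, hn⟩ := exists_of_ser_ne_zero h
      exact hi ⟨n, hn.symm⟩
    rw [this, Pi.zero_apply, zero_mul]

theorem ser_mul_apply (u : ℕ → ZLat → K) (C : FOp K) (j m : ZLat) :
    (ser α ε u * C) j m = ∑ᶠ k : ℕ, u k m * C (j - k • dir α ε) (m + k • dir α ε) :=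
  finsum_ser_mul u m fun i => C (j - i) (m + i)

theorem ser_mem_Rng (u : ℕ → ZLat → K) : ser α ε u ∈ Rng K α ε := by
  refine mem_opEα_iff.2 ⟨0, fun j hj => ?_⟩
  obtain ⟨n, rfl⟩ := exists_of_ser_ne_zero hj
  rw [← natCast_zsmul]
  refine ⟨?_, fun β hβ => ?_⟩
  · rw [zsmul_dir_self, mul_neg, unit_mul_self_mul]
    omega
  · rw [Pi.smul_apply, dir_of_ne hβ, smul_zero, abs_zero]

variable (α ε) in
/-- The series `∑_k u_k Λ_α^{-εk}` as an element of `𝓔_(α)^ε`. -/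
def serR (u : ℕ → ZLat → K) : Rng K α ε := ⟨ser α ε u, ser_mem_Rng u⟩

theorem serR_mem (u : ℕ → ZLat → K) : serR α ε u ∈ Rng0 K α ε := by
  intro j hj β hβ
  obtain ⟨n, rfl⟩ := exists_of_ser_ne_zero hj
  rw [Pi.smul_apply, dir_of_ne hβ, smul_zero]

theorem serR_mul_serR (u t : ℕ → ZLat → K) :
    serR α ε u * serR α ε t = serR α ε fun n m =>
      ∑ k ∈ Finset.range (n + 1), u k m * t (n - k) (m + k • dir α ε) := by
  refine Subtype.ext (ext' fun j m => ?_)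
  change (ser α ε u * ser α ε t) j m = ser α ε (fun n m =>
      ∑ k ∈ Finset.range (n + 1), u k m * t (n - k) (m + k • dir α ε)) j m
  by_cases hj : ∃ n : ℕ, j = n • dir α ε
  · obtain ⟨n, rfl⟩ := hj
    have h1 (k : ℕ) : n • dir α ε - k • dir α ε = ((n : ℤ) - k) • dir α ε := by
      rw [sub_smul, natCast_zsmul, natCast_zsmul]
    rw [ser_mul_apply, ser_nsmul, finsum_eq_sum_of_support_subset (s := Finset.range (n + 1))]
    · refine Finset.sum_congr rfl fun k hk => ?_
      rw [Finset.mem_range] at hk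
      simp only [h1]
      rw [ser_zsmul, if_pos (by omega), show ((n : ℤ) - k).toNat = n - k by omega]
    · intro k hk
      rw [Finset.coe_range, Set.mem_Iio]
      by_contra! hlt
      apply hk
      simp only [h1]
      rw [ser_zsmul, if_neg (by omega), mul_zero]
  · have h2 : ser α ε (fun n m =>
        ∑ k ∈ Finset.range (n + 1), u k m * t (n - k) (m + k • dir α ε)) j = 0 := by
      by_contra h
      exact hj (exists_of_ser_ne_zero h)
    have h1 : (ser α ε u * ser α ε t) j = 0 := by
      by_contra h
      obtain ⟨i, hi, hji⟩ := exists_of_mul_ne_zero h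
      obtain ⟨n, rfl⟩ := exists_of_ser_ne_zero hi
      obtain ⟨k, hk⟩ := exists_of_ser_ne_zero hji
      exact hj ⟨n + k, by rw [add_smul, ← hk, add_sub_cancel]⟩
    rw [h1, h2]

/-- The coefficients of the inverse of a power series in one shift operator. -/
def invCoeff (σ : ZLat) (u : ℕ → ZLat → K) : ℕ → ZLat → K
  | 0 => fun m => (u 0 m)⁻¹
  | n + 1 => fun m => -(u 0 m)⁻¹ *
      ∑ k : Fin (n + 1), u (k + 1) m * invCoeff σ u (n - k) (m + ((k : ℕ) + 1) • σ)

theorem serR_mul_serR_invCoeff {u : ℕ → ZLat → K} (hu : ∀ m, u 0 m ≠ 0) :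
    serR α ε u * serR α ε (invCoeff (dir α ε) u) = 1 := by
  rw [serR_mul_serR]
  refine Subtype.ext (ext' fun j m => ?_)
  rw [coe_one]
  change ser α ε (fun n m => ∑ k ∈ Finset.range (n + 1), u k m *
      invCoeff (dir α ε) u (n - k) (m + k • dir α ε)) j m = _
  by_cases hj : ∃ n : ℕ, j = n • dir α ε
  · obtain ⟨n, rfl⟩ := hj
    rw [ser_nsmul, one_apply]
    rcases n with _ | n
    · simp [invCoeff, hu]
    · rw [Finset.sum_range_succ', if_neg, Finset.sum_range]
      · simp only [Nat.add_sub_add_right, Nat.sub_zero, zero_smul, add_zero]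
        rw [invCoeff]
        simp only [neg_mul, mul_neg, mul_inv_cancel_left₀ (hu m), add_neg_cancel]
      · exact fun h => by simpa using nsmul_dir_injective (h.trans (zero_smul ℕ (dir α ε)).symm)
  · rw [one_apply, if_neg fun h => hj ⟨0, by rw [h, zero_smul]⟩]
    by_contra h
    exact hj (exists_of_ser_ne_zero fun h0 => h (congrFun h0 m))

theorem hasInv0_serR {u : ℕ → ZLat → K} (hu : ∀ m, u 0 m ≠ 0) : HasInv0 (serR α ε u) := by
  have h1 := serR_mul_serR_invCoeff (α := α) (ε := ε) hu
  -- The right inverse has a right inverse of its own, which makes it two-sided.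
  have h2 := serR_mul_serR_invCoeff (α := α) (ε := ε) (u := invCoeff (dir α ε) u)
    fun m => by rw [invCoeff]; exact inv_ne_zero (hu m)
  refine ⟨_, serR_mem _, h1, ?_⟩
  rwa [left_inv_eq_right_inv h1 h2]

theorem hasInv0_mul_shiftR {A : Rng K α ε} (hA : HasInv0 A) (c : ℤ) :
    HasInv0 (A * shiftR K α ε (c • dir α ε)) := by
  obtain ⟨G, hG, h1, h2⟩ := hA
  have hmem : shiftR K α ε (-(c • dir α ε)) ∈ Rng0 K α ε := fun j hj β hβ => by
    rw [eq_zero_of_shift_apply_ne_zero hj, Pi.neg_apply, Pi.smul_apply, dir_of_ne hβ, smul_zero,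
      neg_zero]
  refine ⟨shiftR K α ε (-(c • dir α ε)) * G, mul_mem hmem hG, ?_, ?_⟩
  · rw [mul_assoc, ← mul_assoc (shiftR K α ε _), shiftR_mul, add_neg_cancel, shiftR_zero, one_mul,
      h1]
  · rw [mul_assoc, ← mul_assoc G, h2, one_mul, shiftR_mul, neg_add_cancel, shiftR_zero]

/-- An element of `𝓔_(α)^{0,ε}` with nowhere vanishing leading coefficient is invertible. -/
theorem hasInv0_of_leading (c : ℤ) {A : Rng K α ε}
    (h1 : ∀ j, A.1 j ≠ 0 → (∀ β, β ≠ α → j β = 0) ∧ c ≤ -(ε * j α))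
    (h2 : ∀ m, A.1 (c • dir α ε) m ≠ 0) : HasInv0 A := by
  have hA : A = serR α ε (fun k m => A.1 ((k + c) • dir α ε) m) *
      shiftR K α ε (c • dir α ε) := by
    refine Subtype.ext (ext' fun j m => ?_)
    change _ = (ser α ε (fun (k : ℕ) m => A.1 ((k + c) • dir α ε) m) *
      shift (c • dir α ε) : FOp K) j m
    rw [mul_shift_apply]
    by_cases hj : ∀ β, β ≠ α → j β = 0
    · obtain ⟨d, rfl⟩ : ∃ d : ℤ, j = d • dir α ε := ⟨_, eq_zsmul_dir hj⟩
      rw [← sub_smul, ser_zsmul]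
      split_ifs with hd
      · rw [Int.toNat_of_nonneg hd, sub_add_cancel]
      · by_contra h
        have := (h1 _ fun h0 => h (congrFun h0 m)).2
        rw [zsmul_dir_self, mul_neg, unit_mul_self_mul] at this
        omega
    · have h3 : A.1 j = 0 := by
        by_contra h
        exact hj (h1 j h).1
      have h4 : ser α ε (fun (k : ℕ) m => A.1 ((k + c) • dir α ε) m) (j - c • dir α ε) = 0 := by
        by_contra h
        obtain ⟨n, hn⟩ := exists_of_ser_ne_zero h
        refine hj fun β hβ => ?_
        rw [sub_eq_iff_eq_add] at hn
        rw [hn, Pi.add_apply, Pi.smul_apply, Pi.smul_apply, dir_of_ne hβ, smul_zero, smul_zero,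
          add_zero]
      rw [h3, h4]
  rw [hA]
  refine hasInv0_mul_shiftR (hasInv0_serR fun m => ?_) c
  simpa using h2 m

/-! ### The part of order zero in the other shift operator -/

variable (α) in
/-- The terms that do not contain the shift operator other than `Λ_α`. -/
def row (C : FOp K) : FOp K := fun j m => if ∀ β, β ≠ α → j β = 0 then C j m else 0

theorem row_ne_zero {C : FOp K} {j : ZLat} (h : row α C j ≠ 0) :
    (∀ β, β ≠ α → j β = 0) ∧ C j ≠ 0 := by
  have h1 : ∀ β, β ≠ α → j β = 0 := by
    by_contra hc
    exact h (funext fun m => if_neg hc)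
  refine ⟨h1, fun h0 => h (funext fun m => ?_)⟩
  rw [row, if_pos h1, h0]

theorem deg_of_row (hw : w α = -ε) {j : ZLat} (h : ∀ β, β ≠ α → j β = 0) :
    deg w j = -(ε * j α) := by
  fin_cases α
  · rw [deg, h 1 (by simp)]
    simp only [Fin.zero_eta] at hw ⊢
    rw [hw]; ring
  · rw [deg, h 0 (by simp)]
    simp only [Fin.mk_one] at hw ⊢
    rw [hw]; ring

theorem row_mem_Rng (hw : w α = -ε) {C : FOp K} (hC : C ∈ Ser K w) : row α C ∈ Rng K α ε := by
  obtain ⟨N, hN⟩ := hC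
  refine mem_opEα_iff.2 ⟨|N|, fun j hj => ?_⟩
  obtain ⟨h1, h2⟩ := row_ne_zero hj
  refine ⟨?_, fun β hβ => ?_⟩
  · have := hN j h2
    rw [deg_of_row hw h1] at this
    linarith [neg_abs_le N]
  · rw [h1 β hβ, abs_zero]
    exact abs_nonneg N

section Row

variable [hw : Fact (w α = -ε)]

variable (α ε) in
/-- `row` as an element of `𝓔_(α)^ε`. -/
def rowR (C : Ser K w) : Rng K α ε := ⟨row α C.1, row_mem_Rng hw.1 C.2⟩

/-- An operator in `Λ_α` alone does not mix different exponents of the other shift. -/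
theorem rowR_smul {x : Rng K α ε} (hx : x ∈ Rng0 K α ε) (C : Ser K w) :
    rowR α ε (x • C) = x * rowR α ε C := by
  refine Subtype.ext (ext' fun j m => ?_)
  change (if _ then (x.1 * C.1) j m else 0) = (x.1 * row α C.1) j m
  rw [mul_apply, mul_apply]
  by_cases hj : ∀ β, β ≠ α → j β = 0
  · rw [if_pos hj]
    refine finsum_congr fun i => ?_
    by_cases hi : x.1 i = 0
    · rw [hi, Pi.zero_apply, zero_mul, zero_mul]
    · rw [row, if_pos fun β hβ => by rw [Pi.sub_apply, hj β hβ, hx i hi β hβ, sub_zero]]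
  · rw [if_neg hj]
    refine ((finsum_congr fun i => ?_).trans finsum_zero).symm
    by_cases hi : x.1 i = 0
    · rw [hi, Pi.zero_apply, zero_mul]
    · rw [row, if_neg, mul_zero]
      intro h
      refine hj fun β hβ => ?_
      have := h β hβ
      rwa [Pi.sub_apply, hx i hi β hβ, sub_zero] at this

theorem eq_zero_of_smul_eq_zero {x : Rng K α ε} (hx : x ∈ Rng0 K α ε) {C : Ser K w}
    (hC : HasInv0 (rowR α ε C)) (h : rowR α ε (x • C) = 0) : x = 0 := by
  obtain ⟨G, -, hG, -⟩ := hC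
  rw [rowR_smul hx] at h
  rw [← mul_one x, ← hG, ← mul_assoc, h, zero_mul]

theorem exists_sum_eq (A : Rng K α ε) : ∃ (s : Finset ℤ) (c : ℤ → Rng K α ε),
    (∀ r, c r ∈ Rng0 K α ε) ∧ A = ∑ r ∈ s, c r * shiftR K α ε (r • Pi.single (1 - α) 1) := by
  obtain ⟨N, hN⟩ := mem_opEα_iff.1 A.2
  have hα : 1 - α ≠ α := by fin_cases α <;> decide
  have hβα (β : Fin 2) (hβ : β ≠ α) : β = 1 - α := by
    fin_cases α <;> fin_cases β <;> first | rfl | exact absurd rfl hβ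
  let c (r : ℤ) : FOp K := row α fun j m => A.1 (j + r • Pi.single (1 - α) 1) m
  have hc (r : ℤ) : c r ∈ Rng K α ε := by
    refine mem_opEα_iff.2 ⟨|N|, fun j hj => ?_⟩
    obtain ⟨h1, h2⟩ := row_ne_zero hj
    refine ⟨?_, fun β hβ => by rw [h1 β hβ, abs_zero]; exact abs_nonneg N⟩
    have := (hN (j + r • Pi.single (1 - α) 1) fun h0 => h2 h0).1
    rw [Pi.add_apply, Pi.smul_apply, Pi.single_eq_of_ne hα.symm, smul_zero, add_zero] at this
    exact this.trans (le_abs_self N)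
  refine ⟨Finset.Icc (-N) N, fun r => ⟨c r, hc r⟩, fun r j hj => (row_ne_zero (C := fun j m => A.1 (j + r • Pi.single (1 - α) 1) m) hj).1, ?_⟩
  refine Subtype.ext (ext' fun j m => ?_)
  rw [AddSubgroup.val_finsetSum]
  have h1 : (∑ r ∈ Finset.Icc (-N) N,
      (((⟨c r, hc r⟩ : Rng K α ε) * shiftR K α ε (r • Pi.single (1 - α) 1) : Rng K α ε) :
        FOp K)) j m = ∑ r ∈ Finset.Icc (-N) N, if j (1 - α) = r then A.1 j m else 0 := by
    have h2 (s : Finset ℤ) (f : ℤ → FOp K) : (∑ r ∈ s, f r) j m = ∑ r ∈ s, f r j m := by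
      induction s using Finset.cons_induction with
      | empty => rfl
      | cons a s ha ih => rw [Finset.sum_cons, Finset.sum_cons, FOp.add_apply, ih]
    rw [h2]
    refine Finset.sum_congr rfl fun r _ => ?_
    change (c r * shift _ : FOp K) j m = _
    rw [mul_shift_apply]
    change (if ∀ β, β ≠ α → (j - r • Pi.single (1 - α) 1 : ZLat) β = 0 then
      A.1 (j - r • Pi.single (1 - α) 1 + r • Pi.single (1 - α) 1) m else 0) = _
    simp only [sub_add_cancel]
    refine if_congr ⟨fun h => ?_, fun h β hβ => ?_⟩ rfl rfl
    · have := h (1 - α) hα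
      simpa [sub_eq_zero] using this
    · rw [hβα β hβ]
      simp [h]
  rw [h1, Finset.sum_ite_eq]
  split_ifs with hj
  · rfl
  · by_contra h
    refine hj ?_
    rw [Finset.mem_Icc, ← abs_le]
    exact (hN j fun h0 => h (congrFun h0 m)).2 _ hα

/-- A series in the left ideal generated by a series invariant under the other shift operator
vanishes as soon as its part without that operator does. -/
theorem smul_eq_zero_of_rowR_eq_zero {Z : Ser K w}
    (hinv : ∀ r : ℤ, shiftR K α ε (r • Pi.single (1 - α) 1) • Z = Z)
    (hZ : HasInv0 (rowR α ε Z)) (C : Rng K α ε) (h : rowR α ε (C • Z) = 0) : C • Z = 0 := by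
  obtain ⟨s, c, hc, rfl⟩ := exists_sum_eq C
  -- As `Z` absorbs the powers of the other shift, only the sum of the coefficients of `C` acts, and
  -- this sum lies in `𝓔_(α)^{0,ε}`.
  have h1 : (∑ r ∈ s, c r * shiftR K α ε (r • Pi.single (1 - α) 1)) • Z = (∑ r ∈ s, c r) • Z := by
    rw [Finset.sum_smul, Finset.sum_smul]
    exact Finset.sum_congr rfl fun r _ => by rw [mul_smul, hinv]
  rw [h1] at h ⊢
  rw [eq_zero_of_smul_eq_zero (sum_mem fun r _ => hc r) hZ h, zero_smul]

end Row

/-! ### Division by `H` -/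

theorem conj_mem_Rng0 {P : Rng K α ε} (hP : P ∈ Rng0 K α ε) (i : ZLat) :
    shiftR K α ε i * P * shiftR K α ε (-i) ∈ Rng0 K α ε := by
  intro j hj
  refine hP j fun h0 => hj (funext fun m => ?_)
  change (shift i * P.1 * shift (-i) : FOp K) j m = 0
  rw [mul_shift_apply, shift_mul_apply, sub_neg_eq_add, add_sub_cancel_right, h0, Pi.zero_apply]

/-- Write `Λ` for the other shift. Modulo the left ideal of `H`, `Λ` is `X⁻¹ Y` and `Λ⁻¹` is `Λ⁻¹
(Y⁻¹ X) Λ`. Conjugation by `Λ` preserves `𝓔_(α)^{0,ε}`, so by induction every power of `Λ` reduces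
to it. -/
theorem exists_eq_add_mul {X Y H : Rng K α ε} (hX0 : X ∈ Rng0 K α ε) (hY0 : Y ∈ Rng0 K α ε)
    (hX : HasInv0 X) (hY : HasInv0 Y)
    (hH : H = X * shiftR K α ε (Pi.single (1 - α) 1) - Y) (A : Rng K α ε) :
    ∃ P ∈ Rng0 K α ε, ∃ Q, A = P + Q * H := by
  obtain ⟨X', hX', -, hXX⟩ := hX
  obtain ⟨Y', hY', -, hYY⟩ := hY
  set e : ZLat := Pi.single (1 - α) 1
  have hΛ : shiftR K α ε (-e) * shiftR K α ε e = 1 := by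
    rw [shiftR_mul, neg_add_cancel, shiftR_zero]
  have hplus : shiftR K α ε e = X' * Y + X' * H := by
    rw [hH, mul_sub, ← mul_assoc X' X, hXX, one_mul, add_sub_cancel]
  -- This is `1 = Y⁻¹ X Λ - Y⁻¹ H` multiplied by `Λ⁻¹` on the left.
  have hminus : shiftR K α ε (-e) = shiftR K α ε (-e) * (Y' * X) * shiftR K α ε e -
      shiftR K α ε (-e) * Y' * H := by
    rw [hH, mul_sub, mul_assoc _ Y' Y, hYY, mul_one]
    simp only [mul_assoc]
    rw [sub_sub_cancel]
  have stepP (P Q : Rng K α ε) (hP : P ∈ Rng0 K α ε) : ∃ P' ∈ Rng0 K α ε, ∃ Q',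
      shiftR K α ε e * (P + Q * H) = P' + Q' * H := by
    refine ⟨shiftR K α ε e * P * shiftR K α ε (-e) * (X' * Y),
      mul_mem (conj_mem_Rng0 hP e) (mul_mem hX' hY0),
      shiftR K α ε e * P * shiftR K α ε (-e) * X' + shiftR K α ε e * Q, ?_⟩
    rw [add_mul, ← add_assoc, mul_assoc _ X' H, ← mul_add, ← hplus, mul_assoc _ (shiftR K α ε (-e)),
      hΛ, mul_one, mul_add, mul_assoc]
  have stepM (P Q : Rng K α ε) (hP : P ∈ Rng0 K α ε) : ∃ P' ∈ Rng0 K α ε, ∃ Q',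
      shiftR K α ε (-e) * (P + Q * H) = P' + Q' * H := by
    have hc := conj_mem_Rng0 hP (-e)
    have hc2 := conj_mem_Rng0 (mul_mem hY' hX0) (-e)
    rw [neg_neg] at hc hc2
    refine ⟨shiftR K α ε (-e) * P * shiftR K α ε e * (shiftR K α ε (-e) * (Y' * X) *
      shiftR K α ε e), mul_mem hc hc2, shiftR K α ε (-e) * Q - shiftR K α ε (-e) * P *
        shiftR K α ε e * (shiftR K α ε (-e) * Y'), ?_⟩
    have hΛ' : shiftR K α ε e * shiftR K α ε (-e) = 1 := by
      rw [shiftR_mul, add_neg_cancel, shiftR_zero]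
    rw [sub_mul, mul_assoc _ (shiftR K α ε (-e) * Y') H, add_sub_left_comm, ← mul_sub, ← hminus,
      mul_assoc _ (shiftR K α ε e), hΛ', mul_one, mul_add, mul_assoc, add_comm]
  have hpow (r : ℤ) : ∃ P ∈ Rng0 K α ε, ∃ Q, shiftR K α ε (r • e) = P + Q * H := by
    induction r using Int.induction_on with
    | zero => exact ⟨1, one_mem _, 0, by rw [zero_smul, shiftR_zero, zero_mul, add_zero]⟩
    | succ n ih =>
      obtain ⟨P, hP, Q, hQ⟩ := ih
      obtain ⟨P', hP', Q', hQ'⟩ := stepP P Q hP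
      refine ⟨P', hP', Q', ?_⟩
      rw [← hQ', ← hQ, shiftR_mul, add_smul, one_smul, add_comm]
    | pred n ih =>
      obtain ⟨P, hP, Q, hQ⟩ := ih
      obtain ⟨P', hP', Q', hQ'⟩ := stepM P Q hP
      refine ⟨P', hP', Q', ?_⟩
      rw [← hQ', ← hQ, shiftR_mul, sub_smul, one_smul, neg_add_eq_sub]
  choose P hP Q hQ using hpow
  obtain ⟨s, c, hc, rfl⟩ := exists_sum_eq A
  refine ⟨∑ r ∈ s, c r * P r, sum_mem fun r _ => mul_mem (hc r) (hP r), ∑ r ∈ s, c r * Q r, ?_⟩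
  rw [Finset.sum_mul, ← Finset.sum_add_distrib]
  exact Finset.sum_congr rfl fun r _ => by rw [hQ r, mul_add, mul_assoc]

/-! ### Uniqueness of the remainder and the projections -/

section Annihilated

variable [hw : Fact (w α = -ε)]

theorem eq_of_smul_eq_smul {P P' : Rng K α ε} (hP : P ∈ Rng0 K α ε) (hP' : P' ∈ Rng0 K α ε)
    {Z : Ser K w} (hZ : HasInv0 (rowR α ε Z)) (h : P • Z = P' • Z) : P = P' := by
  rw [← sub_eq_zero]
  refine eq_zero_of_smul_eq_zero (sub_mem hP hP') hZ ?_
  rw [sub_smul, h, sub_self]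
  exact Subtype.ext (ext' fun j m => by
    change (if _ then (0 : K) else 0) = 0
    exact ite_self _)

/-- Existence is division by `H`. For uniqueness, applying two decompositions to `Z` kills the
multiples of `H`, and `Z` separates the remainders. -/
theorem directSumDecomposition {X Y H : Rng K α ε} (hX0 : X ∈ Rng0 K α ε) (hY0 : Y ∈ Rng0 K α ε)
    (hX : HasInv0 X) (hY : HasInv0 Y) (hH : H = X * shiftR K α ε (Pi.single (1 - α) 1) - Y)
    {Z : Ser K w} (hZ : HasInv0 (rowR α ε Z)) (hHZ : H • Z = 0) :
    DirectSumDecomposition α ε (H : FOp K) := by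
  refine ⟨fun P hP => hP.1, fun Q hQ => mul_mem_Rng hQ H.2, fun A hA => ?_⟩
  obtain ⟨P, hP, Q, hQ⟩ := exists_eq_add_mul hX0 hY0 hX hY hH ⟨A, hA⟩
  refine ⟨P, ⟨coe_mem_opEα0 hP, Q, Q.2, congrArg Subtype.val hQ⟩, ?_⟩
  rintro P' ⟨hP', Q', hQ'mem, hQ'⟩
  obtain ⟨hP'mem, hP'0⟩ := mem_opEα0_iff.1 hP'
  refine congrArg Subtype.val (eq_of_smul_eq_smul hP'0 hP hZ ?_)
  have h1 : (⟨A, hA⟩ : Rng K α ε) = ⟨P', hP'mem⟩ + ⟨Q', hQ'mem⟩ * H := Subtype.ext hQ'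
  have h2 := congrArg (· • Z) (hQ.symm.trans h1)
  simp only [add_smul, mul_smul, hHZ, smul_zero, add_zero] at h2
  exact h2.symm

theorem proj_eq {H : Rng K α ε} (hdec : DirectSumDecomposition α ε (H : FOp K))
    {Z : Ser K w} (hZ : HasInv0 (rowR α ε Z)) (hHZ : H • Z = 0) {A P : Rng K α ε}
    (hP : P ∈ Rng0 K α ε) (h : A • Z = P • Z) : proj α ε (H : FOp K) (A : FOp K) = P := by
  obtain ⟨hP', Q', hQ'mem, hQ'⟩ := Classical.epsilon_spec (hdec.2.2 A A.2).exists
  obtain ⟨hP'mem, hP'0⟩ := mem_opEα0_iff.1 hP'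
  refine congrArg Subtype.val (eq_of_smul_eq_smul (P := ⟨_, hP'mem⟩) hP'0 hP hZ ?_)
  have h1 : A = ⟨_, hP'mem⟩ + ⟨Q', hQ'mem⟩ * H := Subtype.ext hQ'
  have h2 := congrArg (· • Z) h1
  simp only [add_smul, mul_smul, hHZ, smul_zero, add_zero] at h2
  rw [← h2, h]

end Annihilated

end ThreeKP
end

noncomputable section
namespace ThreeKP

open FOp

variable {K : Type} [Field K] {α : Fin 2} {ε : ℤˣ} {w : Fin 2 → ℤ}

/-! ### Wave kernels -/

/-- The series in all `Λ^j` with coefficients `v_N(m + e₁ + j)`, where `N = c + deg j`. -/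
def ker (w : Fin 2 → ℤ) (c : ℤ) (v : ℕ → ZLat → K) : FOp K := fun j m =>
  if 0 ≤ c + deg w j then v (c + deg w j).toNat (m + e₁ + j) else 0

/-- The series in all `Λ^j` with coefficients `∑_{p + q = N} u_p(m) v_q(m + e₁ + j)`, where
`N = c + deg j`. -/
def wave (w : Fin 2 → ℤ) (c : ℤ) (u v : ℕ → ZLat → K) : FOp K := fun j m =>
  convol (fun p => u p m) (fun q => v q (m + e₁ + j)) (c + deg w j)

theorem ker_ne_zero {c : ℤ} {v : ℕ → ZLat → K} {j : ZLat} (h : ker w c v j ≠ 0) :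
    0 ≤ c + deg w j := by
  by_contra hc
  exact h (funext fun m => if_neg hc)

theorem wave_ne_zero {c : ℤ} {u v : ℕ → ZLat → K} {j : ZLat} (h : wave w c u v j ≠ 0) :
    0 ≤ c + deg w j := by
  by_contra hc
  exact h (funext fun m => if_neg hc)

theorem wave_apply_of_eq_zero {c : ℤ} (u v : ℕ → ZLat → K) {j : ZLat} (m : ZLat)
    (h : c + deg w j = 0) : wave w c u v j m = u 0 m * v 0 (m + e₁ + j) := by
  simp [wave, h, convol]

theorem ker_mem_Ser (w : Fin 2 → ℤ) (c : ℤ) (v : ℕ → ZLat → K) : ker w c v ∈ Ser K w :=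
  ⟨-c, fun j hj => by linarith [ker_ne_zero hj]⟩

theorem wave_mem_Ser (w : Fin 2 → ℤ) (c : ℤ) (u v : ℕ → ZLat → K) : wave w c u v ∈ Ser K w :=
  ⟨-c, fun j hj => by linarith [wave_ne_zero hj]⟩

/-- `ker` as an element of its module. -/
def kerS (w : Fin 2 → ℤ) (c : ℤ) (v : ℕ → ZLat → K) : Ser K w := ⟨ker w c v, ker_mem_Ser w c v⟩

/-- `wave` as an element of its module. -/
def waveS (w : Fin 2 → ℤ) (c : ℤ) (u v : ℕ → ZLat → K) : Ser K w :=
  ⟨wave w c u v, wave_mem_Ser w c u v⟩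

theorem deg_zsmul (w : Fin 2 → ℤ) (r : ℤ) (j : ZLat) : deg w (r • j) = r * deg w j := by
  simp only [deg, Pi.smul_apply, smul_eq_mul]; ring

theorem deg_dir (hw : w α = -ε) : deg w (dir α ε) = 1 := by
  rw [deg_of_row hw fun β hβ => dir_of_ne hβ, dir, Pi.single_eq_same, mul_neg, neg_neg]
  rcases Int.units_eq_one_or ε with rfl | rfl <;> simp

section

variable [hw : Fact (w α = -ε)]

/-- Passing `Λ^i` across a coefficient turns `m` into `m + i` while `j` drops to `j - i`; hence `m +
e₁ + j` is unchanged and the product is a plain convolution. -/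
theorem serR_smul_kerS (c : ℤ) (u v : ℕ → ZLat → K) :
    serR α ε u • kerS w c v = waveS w c u v := by
  refine Subtype.ext (ext' fun j m => ?_)
  change (ser α ε u * ker w c v) j m =
    convol (fun p => u p m) (fun q => v q (m + e₁ + j)) (c + deg w j)
  rw [ser_mul_apply]
  have h1 (k : ℕ) : c + deg w (j - k • dir α ε) = c + deg w j - k := by
    rw [deg_sub, ← natCast_zsmul, deg_zsmul, deg_dir hw.1]; ring
  have h2 (k : ℕ) : m + k • dir α ε + e₁ + (j - k • dir α ε) = m + e₁ + j := by abel
  simp only [ker, h1, h2]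
  generalize c + deg w j = N
  rw [convol]
  split_ifs with hN
  · rw [Finset.Nat.sum_antidiagonal_eq_sum_range_succ (fun p q => u p m * v q (m + e₁ + j)),
      finsum_eq_sum_of_support_subset (s := Finset.range (N.toNat + 1))]
    · refine Finset.sum_congr rfl fun k hk => ?_
      rw [Finset.mem_range] at hk
      rw [if_pos (by omega), show (N - k).toNat = N.toNat - k by omega]
    · intro k hk
      rw [Finset.coe_range, Set.mem_Iio]
      by_contra! hlt
      exact hk (by simp only; rw [if_neg (by omega), mul_zero])
  · refine (finsum_congr fun k => ?_).trans finsum_zero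
    rw [if_neg (by omega), mul_zero]

theorem shiftR_smul_kerS (i : ZLat) (c : ℤ) (v : ℕ → ZLat → K) :
    shiftR K α ε i • kerS w c v = kerS w (c - deg w i) v := by
  refine Subtype.ext (ext' fun j m => ?_)
  change (shift i * ker w c v : FOp K) j m = ker w _ v j m
  rw [shift_mul_apply, ker, ker, deg_sub, show c + (deg w j - deg w i) = c - deg w i + deg w j by
    ring, show m + i + e₁ + (j - i) = m + e₁ + j by abel]

theorem hasInv0_rowR_kerS (c : ℤ) {v : ℕ → ZLat → K} (hv : ∀ m, v 0 m ≠ 0) :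
    HasInv0 (rowR α ε (kerS w c v)) := by
  refine hasInv0_of_leading (-c) (fun j hj => ?_) fun m => ?_
  · obtain ⟨h1, h2⟩ := row_ne_zero hj
    have := ker_ne_zero h2
    rw [← deg_of_row hw.1 h1]
    exact ⟨h1, by linarith⟩
  · change (if _ then ker w c v ((-c) • dir α ε) m else 0) ≠ 0
    rw [if_pos fun β hβ => by rw [Pi.smul_apply, dir_of_ne hβ, smul_zero], ker, deg_zsmul,
      deg_dir hw.1]
    simpa using hv _

/-- When the other shift has weight zero it fixes the kernel, so the vanishing criterion applies to
`C S` acting on the kernel. -/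
theorem smul_waveS_eq_zero (hw' : w (1 - α) = 0) (c : ℤ) (u : ℕ → ZLat → K) {v : ℕ → ZLat → K}
    (hv : ∀ m, v 0 m ≠ 0) (C : Rng K α ε) (h : rowR α ε (C • waveS w c u v) = 0) :
    C • waveS w c u v = 0 := by
  rw [← serR_smul_kerS (α := α) (ε := ε), ← mul_smul] at h ⊢
  refine smul_eq_zero_of_rowR_eq_zero (fun r => ?_) (hasInv0_rowR_kerS c hv) _ h
  rw [shiftR_smul_kerS, deg_zsmul]
  have : deg w (Pi.single (1 - α) 1) = w (1 - α) := by
    fin_cases α <;> simp [deg]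
  rw [this, hw', mul_zero, sub_zero]

end

variable (α ε) in
/-- The operator `S Λ_α^ε S⁻¹` for `S = ∑_k u_k Λ_α^{-εk}`. -/
def lax (u : ℕ → ZLat → K) : FOp K :=
  ser α ε u * shift (-dir α ε) * invIn (opEα0 K α ε) (ser α ε u)

/-- In `S Λ_α^ε S⁻¹ (S K)` the middle factors cancel, and `Λ_α^ε` has degree `-1`, which raises the
offset `c` of the kernel by one. -/
theorem exists_lax_eq {u : ℕ → ZLat → K} (hu : ∀ m, u 0 m ≠ 0) :
    ∃ L ∈ Rng0 K α ε, (L : FOp K) = lax α ε u ∧ ∀ (w : Fin 2 → ℤ) [Fact (w α = -ε)] (n : ℕ)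
      (c : ℤ) (v : ℕ → ZLat → K), L ^ n • waveS w c u v = waveS w (c + n) u v := by
  have hex : ∃ T ∈ opEα0 K α ε, ser α ε u * T = 1 ∧ T * ser α ε u = 1 := by
    obtain ⟨G, hG, h1, h2⟩ := hasInv0_serR (α := α) (ε := ε) hu
    exact ⟨G, coe_mem_opEα0 hG, congrArg Subtype.val h1, congrArg Subtype.val h2⟩
  have hinv : invIn (opEα0 K α ε) (ser α ε u) = hex.choose := dif_pos hex
  obtain ⟨hT, h1, h2⟩ := hex.choose_spec
  rw [← hinv] at hT h1 h2
  obtain ⟨hTR, hT0⟩ := mem_opEα0_iff.1 hT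
  set T : Rng K α ε := ⟨_, hTR⟩ with hTdef
  have hTS : T * serR α ε u = 1 := Subtype.ext h2
  have hsh : shiftR K α ε (-dir α ε) ∈ Rng0 K α ε := fun j hj β hβ => by
    rw [eq_zero_of_shift_apply_ne_zero hj, Pi.neg_apply, dir_of_ne hβ, neg_zero]
  refine ⟨serR α ε u * shiftR K α ε (-dir α ε) * T, mul_mem (mul_mem (serR_mem u) hsh) hT0, rfl,
    fun w hw n c v => ?_⟩
  induction n generalizing c with
  | zero => simp
  | succ n ih =>
    have hstep : (serR α ε u * shiftR K α ε (-dir α ε) * T) • waveS w c u v =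
        waveS w (c + 1) u v := by
      rw [← serR_smul_kerS (α := α) (ε := ε), ← mul_smul, mul_assoc _ T, hTS, mul_one, mul_smul,
        shiftR_smul_kerS, serR_smul_kerS]
      congr 2
      have : deg w (-dir α ε) = -1 := by
        rw [← neg_one_zsmul, deg_zsmul, deg_dir hw.1, mul_one]
      rw [this, sub_neg_eq_add]
    rw [pow_succ, mul_smul, hstep, ih]
    congr 1
    push_cast
    ring

/-! ### The operator `Λ₁ Δ₂ + ρ` -/

/-- The operator `Λ₁ Δ₂ + ρ`. -/
def hop (ρ : ZLat → K) : FOp K := shift e₁ * (shift e₂ - 1) + scalar ρ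

theorem scalar_mem_Rng (f : ZLat → K) : scalar f ∈ Rng K α ε := by
  refine mem_opEα_iff.2 ⟨0, fun j hj => ?_⟩
  have : j = 0 := by
    by_contra h
    exact hj (funext fun m => if_neg h)
  simp [this]

variable (α ε) in
/-- The functions of `m` as elements of `𝓔_(α)^ε`. -/
def scalarR (f : ZLat → K) : Rng K α ε := ⟨scalar f, scalar_mem_Rng f⟩

theorem scalarR_mem (f : ZLat → K) : scalarR α ε f ∈ Rng0 K α ε := fun j hj β _ => by
  have : j = 0 := by
    by_contra h
    exact hj (funext fun m => if_neg h)
  rw [this]; rfl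

variable (α ε) in
/-- `hop` as an element of `𝓔_(α)^ε`. -/
def hopR (ρ : ZLat → K) : Rng K α ε :=
  shiftR K α ε e₁ * (shiftR K α ε e₂ - 1) + scalarR α ε ρ

theorem hopR_smul_apply [Fact (w α = -ε)] (ρ : ZLat → K) (C : Ser K w) (j m : ZLat) :
    (hopR α ε ρ • C).1 j m =
      C.1 (j - e₁₂) (m + e₁₂) - C.1 (j - e₁) (m + e₁) + ρ m * C.1 j m := by
  rw [hopR, mul_sub, mul_one, shiftR_mul, add_smul, sub_smul]
  change (shift e₁₂ * C.1 : FOp K) j m - (shift e₁ * C.1 : FOp K) j m +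
    (scalar ρ * C.1 : FOp K) j m = _
  rw [shift_mul_apply, shift_mul_apply, scalar_mul_apply]

theorem dir_zero_one : dir 0 1 = -e₁ := by
  funext i; fin_cases i <;> simp [dir, e₁]

theorem dir_zero_neg : dir 0 (-1) = e₁ := by
  funext i; fin_cases i <;> simp [dir, e₁]

theorem dir_one_one : dir 1 1 = -e₂ := by
  funext i; fin_cases i <;> simp [dir, e₂]

theorem dir_one_neg : dir 1 (-1) = e₂ := by
  funext i; fin_cases i <;> simp [dir, e₂]

theorem forall_ne_zero_iff {P : Fin 2 → Prop} : (∀ β, β ≠ 0 → P β) ↔ P 1 := by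
  simp [Fin.forall_fin_two]

theorem forall_ne_one_iff {P : Fin 2 → Prop} : (∀ β, β ≠ 1 → P β) ↔ P 0 := by
  simp [Fin.forall_fin_two]

/-- The leading term is the monomial for `ε = 1` and `-f` for `ε = -1`. -/
theorem hasInv0_shiftR_sub_scalarR {e : ZLat} (he : e = -dir α 1) {f : ZLat → K}
    (hf : ∀ m, f m ≠ 0) : HasInv0 (shiftR K α ε e - scalarR α ε f) := by
  have hval (j m : ZLat) : (shiftR K α ε e - scalarR α ε f).1 j m =
      (if j = e then 1 else 0) - if j = 0 then f m else 0 := rfl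
  have he0 : e ≠ 0 := by
    rw [he]
    exact neg_ne_zero.2 dir_ne_zero
  have hj (j : ZLat) (h : (shiftR K α ε e - scalarR α ε f).1 j ≠ 0) : j = e ∨ j = 0 := by
    by_contra! hc
    exact h (funext fun m => by rw [hval, if_neg hc.1, if_neg hc.2, sub_zero]; rfl)
  have hdir : dir α (-1) = e := by
    rw [he, dir, dir, ← Pi.single_neg]
    simp
  rcases Int.units_eq_one_or ε with rfl | rfl
  · refine hasInv0_of_leading (-1) (fun j h => ?_) fun m => ?_
    · rcases hj j h with rfl | rfl
      · refine ⟨fun β hβ => by rw [he, Pi.neg_apply, dir_of_ne hβ, neg_zero], ?_⟩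
        rw [he]; simp [dir]
      · simp
    · rw [hval, neg_one_zsmul, ← he, if_pos rfl, if_neg he0, sub_zero]
      exact one_ne_zero
  · refine hasInv0_of_leading 0 (fun j h => ?_) fun m => ?_
    · rcases hj j h with rfl | rfl
      · refine ⟨fun β hβ => by rw [he, Pi.neg_apply, dir_of_ne hβ, neg_zero], ?_⟩
        rw [he]; simp [dir]
      · simp
    · rw [hval, zero_smul, if_neg he0.symm, if_pos rfl, zero_sub]
      exact neg_ne_zero.2 (hf m)

theorem shiftR_mem {i : ZLat} (h : ∀ β, β ≠ α → i β = 0) : shiftR K α ε i ∈ Rng0 K α ε :=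
  fun j hj β hβ => by rw [eq_zero_of_shift_apply_ne_zero hj, h β hβ]

theorem scalarR_one : scalarR α ε (1 : ZLat → K) = 1 := rfl

/-- The two readings are `H = Λ₁ Λ₂ - (Λ₁ - ρ)` and `H = (Λ₂ - 1) Λ₁ - (-ρ)`. -/
theorem exists_hopR_eq {ρ : ZLat → K} (hρ : ∀ m, ρ m ≠ 0) :
    ∃ X ∈ Rng0 K α ε, ∃ Y ∈ Rng0 K α ε, HasInv0 X ∧ HasInv0 Y ∧
      hopR α ε ρ = X * shiftR K α ε (Pi.single (1 - α) 1) - Y := by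
  fin_cases α
  · refine ⟨shiftR K _ ε e₁, shiftR_mem (forall_ne_zero_iff.2 rfl),
      shiftR K _ ε e₁ - scalarR _ ε ρ, sub_mem (shiftR_mem (forall_ne_zero_iff.2 rfl))
        (scalarR_mem ρ), ⟨shiftR K _ ε (-e₁), shiftR_mem (forall_ne_zero_iff.2 rfl), ?_, ?_⟩,
      hasInv0_shiftR_sub_scalarR (by rw [← neg_neg e₁, ← dir_zero_one]; rfl) hρ, ?_⟩
    · rw [shiftR_mul, add_neg_cancel, shiftR_zero]
    · rw [shiftR_mul, neg_add_cancel, shiftR_zero]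
    · rw [hopR, mul_sub, mul_one, sub_sub_eq_add_sub, add_sub_right_comm]
      rfl
  · refine ⟨shiftR K _ ε e₂ - scalarR _ ε 1, sub_mem (shiftR_mem (forall_ne_one_iff.2 rfl))
        (scalarR_mem 1), -scalarR _ ε ρ, neg_mem (scalarR_mem ρ),
      hasInv0_shiftR_sub_scalarR (by rw [← neg_neg e₂, ← dir_one_one]; rfl) fun _ => one_ne_zero,
      ?_, ?_⟩
    · refine hasInv0_of_leading 0 (fun j h => ?_) fun m => ?_
      · have hj : j = 0 := by
          by_contra hj
          refine h (funext fun m => ?_)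
          change -(if j = 0 then ρ m else 0) = 0
          rw [if_neg hj, neg_zero]
        simp [hj]
      · change -(if (0 : ℤ) • dir _ ε = 0 then ρ m else 0) ≠ 0
        rw [zero_smul, if_pos rfl]
        exact neg_ne_zero.2 (hρ m)
    · change _ = (shiftR K _ ε e₂ - scalarR _ ε 1) * shiftR K _ ε e₁ - _
      rw [hopR, scalarR_one, mul_sub, sub_mul, mul_one, one_mul, shiftR_mul, shiftR_mul,
        sub_neg_eq_add, add_comm e₁ e₂]

end ThreeKP
end

noncomputable section
namespace ThreeKP

open FOp Polynomial

variable {K : Type} [Field K]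

/-! ### The part of positive order in `Δ₂` or `Δ₂^*` -/

/-- The coefficient of `D^(i+1)` in the expansion of `∑_k a_k (D + 1)^k`. -/
def deltaCoeff (a : ℕ → K) (i : ℕ) : K :=
  ∑ᶠ l : ℕ, (Nat.choose (i + 1 + l) l : K) * a (i + 1 + l)

/-- The part of positive order in `X - 1` of the polynomial `∑_{k ≤ N} a_k X^k`. -/
def posPoly (a : ℕ → K) (N : ℕ) : K[X] :=
  ∑ i ∈ Finset.range N, C (deltaCoeff a i) * (X - 1) ^ (i + 1)

theorem deltaCoeff_eq_zero {a : ℕ → K} {N : ℕ} (ha : ∀ k, N < k → a k = 0) {i : ℕ} (hi : N ≤ i) :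
    deltaCoeff a i = 0 :=
  (finsum_congr fun l => by rw [ha _ (by omega), mul_zero]).trans finsum_zero

theorem taylor_coeff_eq_deltaCoeff {a : ℕ → K} {N : ℕ} (ha : ∀ k, N < k → a k = 0) (i : ℕ) :
    (taylor 1 (∑ k ∈ Finset.range (N + 1), monomial k (a k))).coeff (i + 1) = deltaCoeff a i := by
  rw [taylor_coeff, map_sum, eval_finsetSum, deltaCoeff]
  simp only [hasseDeriv_monomial, eval_monomial, one_pow, mul_one]
  rw [finsum_eq_sum_of_support_subset (s := Finset.range (N + 1))]
  · have h1 : ∑ k ∈ Finset.range (N + 1), (Nat.choose k (i + 1) : K) * a k =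
        ∑ k ∈ Finset.range (i + 1 + (N + 1)), (Nat.choose k (i + 1) : K) * a k := by
      refine Finset.sum_subset (Finset.range_subset_range.2 (by omega)) fun k _ hk => ?_
      rw [Finset.mem_range] at hk
      rw [ha k (by omega), mul_zero]
    rw [h1, Finset.sum_range_add, Finset.sum_eq_zero, zero_add]
    · refine Finset.sum_congr rfl fun l _ => ?_
      rw [Nat.choose_symm_add]
    · intro k hk
      rw [Finset.mem_range] at hk
      rw [Nat.choose_eq_zero_of_lt hk, Nat.cast_zero, zero_mul]
  · intro l hl
    rw [Finset.coe_range, Set.mem_Iio]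
    by_contra! h
    exact hl (by simp only; rw [ha _ (by omega), mul_zero])

/-- This is Taylor expansion at `1`. Thus the positive part is `f - f(1)`: it keeps every
coefficient of `f` except the constant one, and it vanishes at `1`. Only these two properties and
the degree bound matter later. -/
theorem exists_eq_C_add_posPoly {a : ℕ → K} {N : ℕ} (ha : ∀ k, N < k → a k = 0) :
    ∃ c : K, ∑ k ∈ Finset.range (N + 1), monomial k (a k) = C c + posPoly a N := by
  set f : K[X] := ∑ k ∈ Finset.range (N + 1), monomial k (a k) with hf
  have hdeg : (taylor 1 f).natDegree < N + 1 := by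
    rw [natDegree_taylor, Nat.lt_succ_iff]
    refine natDegree_sum_le_of_forall_le _ _ fun k hk => ?_
    rw [Finset.mem_range] at hk
    exact (natDegree_monomial_le _).trans (by omega)
  refine ⟨(taylor 1 f).coeff 0, ?_⟩
  conv_lhs => rw [← sum_taylor_eq f 1]
  rw [sum_over_range' _ (by simp) _ hdeg, Finset.sum_range_succ', pow_zero, mul_one, add_comm,
    posPoly]
  simp only [taylor_coeff_eq_deltaCoeff ha, hf, map_one]

theorem coeff_posPoly {a : ℕ → K} {N : ℕ} (ha : ∀ k, N < k → a k = 0) {k : ℕ} (hk : k ≠ 0) :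
    (posPoly a N).coeff k = a k := by
  obtain ⟨c, hc⟩ := exists_eq_C_add_posPoly ha
  have h := congrArg (fun p => coeff p k) hc
  simp only [finsetSum_coeff, coeff_monomial, coeff_add, coeff_C, if_neg hk, zero_add] at h
  rw [← h, Finset.sum_ite_eq']
  split_ifs with h2
  · rfl
  · exact (ha k (by rw [Finset.mem_range] at h2; omega)).symm

theorem eval_posPoly (a : ℕ → K) (N : ℕ) : (posPoly a N).eval 1 = 0 := by
  simp [posPoly, eval_finsetSum]

theorem natDegree_posPoly (a : ℕ → K) (N : ℕ) : (posPoly a N).natDegree ≤ N := by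
  refine natDegree_sum_le_of_forall_le _ _ fun i hi => ?_
  rw [Finset.mem_range] at hi
  refine (natDegree_C_mul_le _ _).trans (natDegree_pow_le.trans ?_)
  rw [← C_1, natDegree_X_sub_C]
  omega

variable {α : Fin 2} {ε : ℤˣ}

theorem serR_coeff_mul (f g : K[X]) : serR α ε (fun k _ => (f * g).coeff k) =
    serR α ε (fun k _ => f.coeff k) * serR α ε (fun k _ => g.coeff k) := by
  rw [serR_mul_serR]
  congr 1
  funext n m
  rw [coeff_mul, Finset.Nat.sum_antidiagonal_eq_sum_range_succ (fun p q => f.coeff p * g.coeff q)]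

theorem serR_coeff_one : serR α ε (fun k _ => (1 : K[X]).coeff k) = 1 := by
  refine Subtype.ext (ext' fun j m => ?_)
  rw [coe_one, one_apply]
  change ser α ε (fun k _ => (1 : K[X]).coeff k) j m = _
  by_cases hj : ∃ n : ℕ, j = n • dir α ε
  · obtain ⟨n, rfl⟩ := hj
    rw [ser_nsmul, coeff_one]
    refine if_congr ⟨fun h => by rw [h, zero_smul], fun h => ?_⟩ rfl rfl
    exact nsmul_dir_injective (h.trans (zero_smul ℕ (dir α ε)).symm)
  · rw [if_neg fun h => hj ⟨0, by rw [h, zero_smul]⟩]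
    by_contra h
    exact hj (exists_of_ser_ne_zero fun h0 => h (congrFun h0 m))

theorem serR_coeff_X : serR α ε (fun k _ => (X : K[X]).coeff k) = shiftR K α ε (dir α ε) := by
  refine Subtype.ext (ext' fun j m => ?_)
  change ser α ε (fun k _ => (X : K[X]).coeff k) j m = (shift (dir α ε) : FOp K) j m
  rw [shift_apply]
  by_cases hj : ∃ n : ℕ, j = n • dir α ε
  · obtain ⟨n, rfl⟩ := hj
    rw [ser_nsmul, coeff_X]
    refine if_congr ⟨fun h => by rw [← h, one_smul], fun h => ?_⟩ rfl rfl
    exact (nsmul_dir_injective (h.trans (one_smul ℕ (dir α ε)).symm)).symm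
  · rw [if_neg fun h => hj ⟨1, by rw [h, one_smul]⟩]
    by_contra h
    exact hj (exists_of_ser_ne_zero fun h0 => h (congrFun h0 m))

theorem ser_sub (u t : ℕ → ZLat → K) : ser α ε (fun k m => u k m - t k m) = ser α ε u - ser α ε t :=
  ext' fun j m => by
    rw [FOp.sub_apply, ser, ser, ser]
    split_ifs <;> simp

theorem serR_coeff_X_sub_one_pow (i : ℕ) : serR α ε (fun k _ => ((X - 1 : K[X]) ^ i).coeff k) =
    (shiftR K α ε (dir α ε) - 1) ^ i := by
  induction i with
  | zero => rw [pow_zero, pow_zero, serR_coeff_one]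
  | succ i ih =>
    rw [pow_succ, pow_succ, serR_coeff_mul, ih, ← serR_coeff_X, ← serR_coeff_one]
    congr 1
    refine Subtype.ext ?_
    change ser α ε (fun k _ => (X - 1 : K[X]).coeff k) =
      ser α ε (fun k _ => (X : K[X]).coeff k) - ser α ε (fun k _ => (1 : K[X]).coeff k)
    rw [← ser_sub]
    simp only [coeff_sub]

theorem coe_sum_apply (s : Finset ℕ) (f : ℕ → FOp K) (j m : ZLat) :
    (∑ i ∈ s, f i) j m = ∑ i ∈ s, f i j m := by
  induction s using Finset.cons_induction with
  | empty => rfl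
  | cons a s ha ih => rw [Finset.sum_cons, Finset.sum_cons, FOp.add_apply, ih]

theorem dir_one_neg_unit (ε : ℤˣ) : dir 1 (-ε) = Pi.single 1 (ε : ℤ) := by
  rw [dir, Units.val_neg, neg_neg]

/-- Negative powers of `Λ₂^ε` do not contribute to positive powers of `D`, so a polynomial
computation suffices. The sign in `ser 1 (-ε)` appears because that series runs over powers of
`Λ₂^ε`. -/
theorem deltaPosPart_eq {A : FOp K} {N : ℕ} (hN : ∀ j, A j ≠ 0 → ε * j 1 ≤ N) :
    deltaPosPart ε A = ser 1 (-ε) fun k m =>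
      (posPoly (fun i => A (Pi.single 1 (ε * (i : ℤ))) m) N).coeff k := by
  have ha (m : ZLat) (k : ℕ) (hk : N < k) : A (Pi.single 1 (ε * (k : ℤ))) m = 0 := by
    by_contra h
    have := hN _ fun h0 => h (congrFun h0 m)
    rw [Pi.single_eq_same, unit_mul_self_mul] at this
    omega
  have hterm (i : ℕ) : (scalar (fun m => ∑ᶠ l : ℕ,
      (Nat.choose (i + 1 + l) l : K) * A (Pi.single 1 (ε * ((i + 1 + l : ℕ) : ℤ))) m) *
      (shift (Pi.single 1 (ε : ℤ)) - 1 : FOp K) ^ (i + 1)) = fun j m =>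
      deltaCoeff (fun k => A (Pi.single 1 (ε * (k : ℤ))) m) i *
        ser 1 (-ε) (fun k _ => ((X - 1 : K[X]) ^ (i + 1)).coeff k) j m := by
    refine ext' fun j m => ?_
    rw [scalar_mul_apply]
    congr 1
    have h := congrArg Subtype.val (serR_coeff_X_sub_one_pow (K := K) (α := 1) (ε := -ε) (i + 1))
    rw [coe_pow, coe_sub, coe_one] at h
    change ser 1 (-ε) (fun k _ => ((X - 1 : K[X]) ^ (i + 1)).coeff k) = (shift (dir 1 (-ε)) - 1 : FOp K) ^ (i + 1) at h
    rw [h, dir_one_neg_unit]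
  unfold deltaPosPart
  rw [finsum_eq_sum_of_support_subset (s := Finset.range N)]
  · refine ext' fun j m => ?_
    rw [coe_sum_apply]
    simp only [hterm, ser, posPoly, finsetSum_coeff, coeff_C_mul]
    split_ifs with h
    · rfl
    · simp
  · intro i hi
    rw [Finset.coe_range, Set.mem_Iio]
    by_contra! h
    refine hi ?_
    simp only [hterm]
    exact ext' fun j m => by rw [deltaCoeff_eq_zero (ha m) h, zero_mul]; rfl

theorem mem_opE_of_abs_le {A : FOp K} {N : ℤ} (h : ∀ j, A j ≠ 0 → |j 0| ≤ N ∧ |j 1| ≤ N) :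
    A ∈ opE K :=
  (finite_box N).subset h

section DeltaPosPart

variable {A : FOp K} (hA : A ∈ opEα0 K 1 ε)

include hA

theorem exists_nat_le_of_mem : ∃ N : ℕ, ∀ j, A j ≠ 0 → ε * j 1 ≤ N := by
  obtain ⟨N, hN⟩ := mem_opEα_iff.1 hA.1
  exact ⟨N.toNat, fun j hj => (hN j hj).1.trans (Int.self_le_toNat N)⟩

theorem deltaPosPart_ne_zero {j : ZLat} (h : deltaPosPart ε A j ≠ 0) : j 0 = 0 ∧ 0 ≤ ε * j 1 := by
  obtain ⟨N, hN⟩ := exists_nat_le_of_mem hA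
  rw [deltaPosPart_eq hN] at h
  obtain ⟨n, rfl⟩ := exists_of_ser_ne_zero h
  rw [dir_one_neg_unit, ← natCast_zsmul]
  refine ⟨by simp, ?_⟩
  rw [Pi.smul_apply, Pi.single_eq_same, smul_eq_mul, mul_comm (n : ℤ), unit_mul_self_mul]
  exact Int.natCast_nonneg n

theorem deltaPosPart_mem_opE : deltaPosPart ε A ∈ opE K := by
  obtain ⟨N, hN⟩ := exists_nat_le_of_mem hA
  refine mem_opE_of_abs_le (N := N) fun j h => ?_
  obtain ⟨h0, -⟩ := deltaPosPart_ne_zero hA h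
  refine ⟨by rw [h0, abs_zero]; exact Int.natCast_nonneg N, ?_⟩
  rw [deltaPosPart_eq hN] at h
  obtain ⟨n, rfl⟩ := exists_of_ser_ne_zero h
  have hn : n ≤ N := by
    by_contra! hlt
    refine h (funext fun m => ?_)
    rw [ser_nsmul]
    exact coeff_eq_zero_of_natDegree_lt ((natDegree_posPoly _ _).trans_lt hlt)
  rw [dir_one_neg_unit, ← natCast_zsmul, Pi.smul_apply, Pi.single_eq_same, smul_eq_mul, abs_mul,
    show |(ε : ℤ)| = 1 by rcases Int.units_eq_one_or ε with rfl | rfl <;> rfl, mul_one]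
  simpa using hn

theorem sub_deltaPosPart_ne_zero {j : ZLat} (h : (A - deltaPosPart ε A) j ≠ 0) :
    j 0 = 0 ∧ ε * j 1 ≤ 0 := by
  have hj0 : j 0 = 0 := by
    by_cases hAj : A j = 0
    · refine (deltaPosPart_ne_zero hA (j := j) fun h0 => h ?_).1
      change A j - deltaPosPart ε A j = 0
      rw [hAj, h0, sub_zero]
    · by_contra hj
      exact hAj (hA.2 j ⟨0, by decide, hj⟩)
  refine ⟨hj0, ?_⟩
  by_contra! hlt
  refine h (funext fun m => ?_)
  obtain ⟨N, hN⟩ := exists_nat_le_of_mem hA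
  obtain ⟨n, hn⟩ := Int.eq_ofNat_of_zero_le hlt.le
  have hj : j = n • dir 1 (-ε) := by
    rw [dir_one_neg_unit, ← natCast_zsmul, ← hn]
    funext i
    fin_cases i
    · simpa using hj0
    · change j 1 = (ε * j 1 : ℤ) • ε
      rw [smul_eq_mul, mul_comm, unit_mul_self_mul]
  rw [FOp.sub_apply, deltaPosPart_eq hN, hj, ser_nsmul, coeff_posPoly _ (by omega)]
  · have hs : n • dir 1 (-ε) = Pi.single 1 (ε * (n : ℤ)) := by
      rw [dir_one_neg_unit, ← natCast_zsmul, ← Pi.single_smul, smul_eq_mul, mul_comm]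
    exact sub_eq_zero.2 (by rw [hs])
  · intro k hk
    by_contra h
    have := hN _ fun h0 => h (congrFun h0 m)
    rw [Pi.single_eq_same, unit_mul_self_mul] at this
    omega

/-- The sum of the coefficients is the value at `Λ₂ = 1`, where `D` vanishes. -/
theorem finsum_deltaPosPart (m : ZLat) : ∑ᶠ i, deltaPosPart ε A i m = 0 := by
  obtain ⟨N, hN⟩ := exists_nat_le_of_mem hA
  have h := finsum_ser_mul (α := 1) (ε := -ε) (fun k m =>
      (posPoly (fun i => A (Pi.single 1 (ε * (i : ℤ))) m) N).coeff k) m fun _ => 1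
  rw [← deltaPosPart_eq hN] at h
  simp only [mul_one] at h
  rw [h, ← eval_posPoly (fun i => A (Pi.single 1 (ε * (i : ℤ))) m) N,
    eval_eq_sum_range' (Nat.lt_succ_of_le (natDegree_posPoly _ _)),
    finsum_eq_sum_of_support_subset (s := Finset.range N.succ)]
  · simp
  · intro k hk
    rw [Finset.coe_range, Set.mem_Iio, Nat.lt_succ_iff]
    by_contra! hlt
    exact hk (coeff_eq_zero_of_natDegree_lt ((natDegree_posPoly _ _).trans_lt hlt))

end DeltaPosPart

end ThreeKP
end

noncomputable section
namespace ThreeKP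

open FOp

variable {K : Type} [Field K]

/-! ### The bilinear equations at `t = t'` -/

/-- The degree of the kernel of the first wave function. -/
def w₁ : Fin 2 → ℤ := ![-1, 0]

/-- The degree of the kernel of the second wave function. -/
def w₂ : Fin 2 → ℤ := ![0, 1]

/-- The degree of the kernel of the third wave function. -/
def w₃ : Fin 2 → ℤ := ![1, -1]

instance : Fact (w₁ 0 = -((1 : ℤˣ) : ℤ)) := ⟨rfl⟩
instance : Fact (w₂ 1 = -((-1 : ℤˣ) : ℤ)) := ⟨rfl⟩
instance : Fact (w₃ 0 = -((-1 : ℤˣ) : ℤ)) := ⟨rfl⟩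
instance : Fact (w₃ 1 = -((1 : ℤˣ) : ℤ)) := ⟨rfl⟩

theorem deg_w₁ (j : ZLat) : deg w₁ j = -j 0 := by simp [deg, w₁]
theorem deg_w₂ (j : ZLat) : deg w₂ j = j 1 := by simp [deg, w₂]
theorem deg_w₃ (j : ZLat) : deg w₃ j = j 0 - j 1 := by simp [deg, w₃]; ring

/-- The properties of the coefficients `u i` of the wave operators and `v i` of the dual wave
operators that follow from the bilinear equations at `t = t'`. -/
structure IsWaveData (n : Fin 3 → ℕ) (u v : Fin 3 → ℕ → ZLat → K) (ρ : ZLat → K) : Prop where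
  bilinear : ∀ l : ℕ, wave w₁ (n 0 * l) (u 0) (v 0) =
    wave w₂ (n 1 * l - 1) (u 1) (v 1) + wave w₃ (n 2 * l) (u 2) (v 2)
  u_zero : ∀ m, u 0 0 m = 1
  v_zero : ∀ m, v 0 0 m = 1
  u_ne_zero : ∀ i m, u i 0 m ≠ 0
  v_ne_zero : ∀ i m, v i 0 m ≠ 0
  v_two : ∀ m, v 2 0 (m + e₁) = (u 2 0 m)⁻¹
  rho_eq : ∀ m, ρ m = -(u 2 0 (m + e₁₂) / u 2 0 m)

theorem apply_eq_zero_of_imp {A : FOp K} {j : ZLat} {p : Prop} (h : A j ≠ 0 → p) (hp : ¬p)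
    (m : ZLat) : A j m = 0 := by
  by_contra hA
  exact hp (h fun h0 => hA (congrFun h0 m))

theorem opE_subset_Rng {A : FOp K} (hA : A ∈ opE K) (α : Fin 2) (ε : ℤˣ) : A ∈ Rng K α ε := by
  obtain ⟨B, hB⟩ := (hA.image fun j => |j 0| + |j 1|).bddAbove
  refine mem_opEα_iff.2 ⟨B, fun j hj => ?_⟩
  have h1 : |j 0| + |j 1| ≤ B := hB ⟨j, hj, rfl⟩
  have h2 (β : Fin 2) : |j β| ≤ B := by
    fin_cases β
    · exact (le_add_of_nonneg_right (abs_nonneg _)).trans h1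
    · exact (le_add_of_nonneg_left (abs_nonneg _)).trans h1
  refine ⟨?_, fun β _ => h2 β⟩
  refine (le_abs_self _).trans ((le_of_eq ?_).trans (h2 α))
  rcases Int.units_eq_one_or ε with rfl | rfl <;> simp

/-- Needed for `W₂ + W₃`, whose summands have degrees bounded with respect to different weights;
finiteness has to come from `A` alone. -/
theorem mul_add_of_mem_opE {A : FOp K} (hA : A ∈ opE K) (C D : FOp K) :
    A * (C + D) = A * C + A * D := by
  have hfin (C : FOp K) (j m : ZLat) :
      Function.HasFiniteSupport fun i => A i m * C (j - i) (m + i) :=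
    Set.Finite.subset hA fun i hi h0 => hi (by simp only [h0, Pi.zero_apply, zero_mul])
  refine ext' fun j m => ?_
  rw [FOp.add_apply, mul_apply, mul_apply, mul_apply,
    ← finsum_add_distrib (hfin C j m) (hfin D j m)]
  exact finsum_congr fun i => by rw [FOp.add_apply, mul_add]

theorem add_mem_opE {A B : FOp K} (hA : A ∈ opE K) (hB : B ∈ opE K) : A + B ∈ opE K := by
  refine (Set.Finite.union hA hB).subset fun j hj => ?_
  by_cases h : A j = 0
  · exact Or.inr fun h0 => hj (by change A j + B j = 0; rw [h, h0, add_zero])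
  · exact Or.inl h

theorem row_apply {α : Fin 2} {C : FOp K} {j : ZLat} (h : ∀ β, β ≠ α → j β = 0) (m : ZLat) :
    row α C j m = C j m :=
  if_pos h

theorem rowR_eq_zero {α : Fin 2} {ε : ℤˣ} {w : Fin 2 → ℤ} [Fact (w α = -ε)] {C : Ser K w}
    (h : ∀ j, (∀ β, β ≠ α → j β = 0) → ∀ m, C.1 j m = 0) : rowR α ε C = 0 := by
  refine Subtype.ext (ext' fun j m => ?_)
  change (if _ then C.1 j m else 0) = 0
  split_ifs with hj
  · exact h j hj m
  · rfl

/-! ### Supports of the wave kernels and their annihilation by `H` -/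

namespace IsWaveData

variable {n : Fin 3 → ℕ} {u v : Fin 3 → ℕ → ZLat → K} {ρ : ZLat → K}

theorem bilinear_zero (h : IsWaveData n u v ρ) :
    wave w₁ 0 (u 0) (v 0) = wave w₂ (-1) (u 1) (v 1) + wave w₃ 0 (u 2) (v 2) := by
  simpa using h.bilinear 0

theorem le_of_wave₁ {j : ZLat} (hj : wave w₁ 0 (u 0) (v 0) j ≠ 0) : j 0 ≤ 0 := by
  have := wave_ne_zero hj
  rw [deg_w₁] at this
  linarith

theorem le_of_wave₂ {j : ZLat} (hj : wave w₂ (-1) (u 1) (v 1) j ≠ 0) : 1 ≤ j 1 := by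
  have := wave_ne_zero hj
  rw [deg_w₂] at this
  linarith

theorem le_of_wave₃ {j : ZLat} (hj : wave w₃ 0 (u 2) (v 2) j ≠ 0) : j 1 ≤ j 0 := by
  have := wave_ne_zero hj
  rw [deg_w₃] at this
  linarith

variable (h : IsWaveData n u v ρ)

include h

theorem wave₁_apply {j : ZLat} (hj : j 0 = 0) (m : ZLat) : wave w₁ 0 (u 0) (v 0) j m = 1 := by
  rw [wave_apply_of_eq_zero _ _ _ (by rw [deg_w₁, hj]; rfl), h.u_zero, h.v_zero, mul_one]

theorem wave₃_apply {j : ZLat} (hj1 : j 1 ≤ 0) (m : ZLat) :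
    wave w₃ 0 (u 2) (v 2) j m = wave w₁ 0 (u 0) (v 0) j m := by
  rw [h.bilinear_zero, FOp.add_apply, apply_eq_zero_of_imp le_of_wave₂ (by omega), zero_add]

theorem wave₂_apply {j : ZLat} (hj0 : j 0 = 0) (hj1 : 1 ≤ j 1) (m : ZLat) :
    wave w₂ (-1) (u 1) (v 1) j m = 1 := by
  rw [← h.wave₁_apply hj0 m, h.bilinear_zero, FOp.add_apply,
    apply_eq_zero_of_imp (le_of_wave₃ (j := j)) (by omega), add_zero]

theorem hasInv0_row₁ : HasInv0 (rowR 0 1 (waveS w₁ 0 (u 0) (v 0))) := by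
  refine hasInv0_of_leading 0 (fun j hj => ?_) fun m => ?_
  · obtain ⟨h1, h2⟩ := row_ne_zero hj
    have := le_of_wave₁ h2
    exact ⟨h1, by simpa using this⟩
  · change row 0 (wave w₁ 0 (u 0) (v 0)) ((0 : ℤ) • dir 0 1) m ≠ 0
    rw [row_apply (by simp), h.wave₁_apply (by simp)]
    exact one_ne_zero

theorem hasInv0_row₂ : HasInv0 (rowR 1 (-1) (waveS w₂ (-1) (u 1) (v 1))) := by
  refine hasInv0_of_leading 1 (fun j hj => ?_) fun m => ?_
  · obtain ⟨h1, h2⟩ := row_ne_zero hj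
    have := le_of_wave₂ h2
    exact ⟨h1, by simpa using this⟩
  · change row 1 (wave w₂ (-1) (u 1) (v 1)) ((1 : ℤ) • dir 1 (-1)) m ≠ 0
    rw [one_smul, row_apply fun β hβ => dir_of_ne hβ, h.wave₂_apply (by simp [dir]) (by simp [dir])]
    exact one_ne_zero

theorem hasInv0_row₃ : HasInv0 (rowR 0 (-1) (waveS w₃ 0 (u 2) (v 2))) := by
  refine hasInv0_of_leading 0 (fun j hj => ?_) fun m => ?_
  · obtain ⟨h1, h2⟩ := row_ne_zero hj
    have h3 := le_of_wave₃ h2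
    rw [h1 1 (by decide)] at h3
    exact ⟨h1, by simpa using h3⟩
  · change row 0 (wave w₃ 0 (u 2) (v 2)) ((0 : ℤ) • dir 0 (-1)) m ≠ 0
    rw [row_apply (by simp), h.wave₃_apply (by simp), h.wave₁_apply (by simp)]
    exact one_ne_zero

theorem hasInv0_row₃' : HasInv0 (rowR 1 1 (waveS w₃ 0 (u 2) (v 2))) := by
  refine hasInv0_of_leading 0 (fun j hj => ?_) fun m => ?_
  · obtain ⟨h1, h2⟩ := row_ne_zero hj
    have h3 := le_of_wave₃ h2
    rw [h1 0 (by decide)] at h3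
    exact ⟨h1, by simpa using h3⟩
  · change row 1 (wave w₃ 0 (u 2) (v 2)) ((0 : ℤ) • dir 1 1) m ≠ 0
    rw [row_apply (by simp), h.wave₃_apply (by simp), h.wave₁_apply (by simp)]
    exact one_ne_zero

/-- By invariance under `Λ₂` only the coefficients with `j 1 = 0` need checking. They involve `W₁`
at `j 1 ≤ 0`, where it equals `W₃`. -/
theorem hopR_smul_wave₁ : hopR 0 1 ρ • waveS w₁ 0 (u 0) (v 0) = 0 := by
  refine smul_waveS_eq_zero rfl 0 _ (h.v_ne_zero 0) _ (rowR_eq_zero fun j hj m => ?_)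
  have hj1 : j 1 = 0 := hj 1 (by decide)
  rw [hopR_smul_apply]
  change wave w₁ 0 (u 0) (v 0) _ _ - wave w₁ 0 (u 0) (v 0) _ _ +
    ρ m * wave w₁ 0 (u 0) (v 0) _ _ = 0
  have c1 : (j - e₁₂) 0 = j 0 - 1 := rfl
  have c2 : (j - e₁) 0 = j 0 - 1 := rfl
  have c3 : (j - e₁₂) 1 = j 1 - 1 := rfl
  have c4 : (j - e₁) 1 = j 1 := sub_zero _
  rcases lt_trichotomy (j 0) 0 with hneg | hzero | hpos
  -- For `j 0 < 0` all three terms lie outside the support `j 1 ≤ j 0` of `W₃`.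
  · rw [← h.wave₃_apply (by omega), ← h.wave₃_apply (by omega),
      ← h.wave₃_apply (by omega), apply_eq_zero_of_imp le_of_wave₃ (by omega),
      apply_eq_zero_of_imp le_of_wave₃ (by omega), apply_eq_zero_of_imp le_of_wave₃ (by omega)]
    ring
  -- At `j = 0` the term at `j - e₁₂` is a leading coefficient of `W₃`, equal to `u₂(m + e) / u₂(m)
  -- = -ρ(m)`; it cancels `ρ · 1`.
  · have hj0 : j = 0 := by
      funext i
      fin_cases i
      · exact hzero
      · exact hj1
    rw [← h.wave₃_apply (by omega), ← h.wave₃_apply (by omega),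
      h.wave₁_apply hzero, apply_eq_zero_of_imp (le_of_wave₃ (j := j - e₁)) (by omega),
      wave_apply_of_eq_zero _ _ _ (by rw [deg_w₃]; omega), h.rho_eq, hj0,
      show m + e₁₂ + e₁ + (0 - e₁₂) = m + e₁ by abel, h.v_two]
    ring
  -- For `j 0 > 0` only `j 0 = 1` leaves anything, namely `1 - 1`.
  · rw [apply_eq_zero_of_imp (le_of_wave₁ (j := j)) (by omega)]
    by_cases hj2 : j 0 = 1
    · rw [h.wave₁_apply (by omega), h.wave₁_apply (by omega)]
      ring
    · rw [apply_eq_zero_of_imp le_of_wave₁ (by omega), apply_eq_zero_of_imp le_of_wave₁ (by omega)]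
      ring

theorem hop_apply_add (j m : ZLat) :
    (hopR 1 (-1) ρ • waveS w₂ (-1) (u 1) (v 1)).1 j m +
      (hopR 0 (-1) ρ • waveS w₃ 0 (u 2) (v 2)).1 j m = 0 := by
  have h1 : (hopR 0 1 ρ • waveS w₁ 0 (u 0) (v 0)).1 j m = 0 := by
    rw [h.hopR_smul_wave₁]; rfl
  rw [hopR_smul_apply] at h1 ⊢
  rw [hopR_smul_apply]
  refine Eq.trans ?_ h1
  have h2 (j m : ZLat) : (waveS w₁ 0 (u 0) (v 0)).1 j m =
      (waveS w₂ (-1) (u 1) (v 1)).1 j m + (waveS w₃ 0 (u 2) (v 2)).1 j m :=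
    congrFun (congrFun h.bilinear_zero j) m
  rw [h2, h2, h2]
  ring

/-- On `j 0 = 0` the support of `W₂` settles `j 1 ≤ 0`. For `j 1 > 0` the series `H W₃` has no
terms, and `H W₂ + H W₃ = 0`. -/
theorem hopR_smul_wave₂ : hopR 1 (-1) ρ • waveS w₂ (-1) (u 1) (v 1) = 0 := by
  refine smul_waveS_eq_zero rfl _ _ (h.v_ne_zero 1) _ (rowR_eq_zero fun j hj m => ?_)
  have hj0 : j 0 = 0 := hj 0 (by decide)
  have c1 : (j - e₁₂) 0 = j 0 - 1 := rfl
  have c2 : (j - e₁) 0 = j 0 - 1 := rfl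
  have c3 : (j - e₁₂) 1 = j 1 - 1 := rfl
  have c4 : (j - e₁) 1 = j 1 := sub_zero _
  by_cases hj1 : j 1 ≤ 0
  · rw [hopR_smul_apply]
    change wave w₂ (-1) (u 1) (v 1) _ _ - wave w₂ (-1) (u 1) (v 1) _ _ +
      ρ m * wave w₂ (-1) (u 1) (v 1) _ _ = 0
    rw [apply_eq_zero_of_imp le_of_wave₂ (by omega), apply_eq_zero_of_imp le_of_wave₂ (by omega),
      apply_eq_zero_of_imp le_of_wave₂ (by omega)]
    ring
  · have h1 := h.hop_apply_add j m
    rw [hopR_smul_apply ρ (waveS w₃ 0 (u 2) (v 2))] at h1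
    refine Eq.trans (Eq.trans ?_ h1) rfl
    change _ = _ + (wave w₃ 0 (u 2) (v 2) _ _ - wave w₃ 0 (u 2) (v 2) _ _ +
      ρ m * wave w₃ 0 (u 2) (v 2) _ _)
    rw [apply_eq_zero_of_imp le_of_wave₃ (by omega), apply_eq_zero_of_imp le_of_wave₃ (by omega),
      apply_eq_zero_of_imp le_of_wave₃ (by omega)]
    ring

theorem hopR_smul_wave₃ : hopR 0 (-1) ρ • waveS w₃ 0 (u 2) (v 2) = 0 := by
  refine Subtype.ext (ext' fun j m => ?_)
  have h1 := h.hop_apply_add j m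
  rw [h.hopR_smul_wave₂] at h1
  exact (zero_add _).symm.trans h1

theorem hopR_smul_wave₃' : hopR 1 1 ρ • waveS w₃ 0 (u 2) (v 2) = 0 :=
  Subtype.ext (congrArg Subtype.val h.hopR_smul_wave₃)

theorem rho_ne_zero (m : ZLat) : ρ m ≠ 0 := by
  rw [h.rho_eq]
  exact neg_ne_zero.2 (div_ne_zero (h.u_ne_zero 2 _) (h.u_ne_zero 2 _))

theorem directSumDecomposition_hop (α : Fin 2) (ε : ℤˣ) :
    DirectSumDecomposition α ε (hop ρ) := by
  have key (α : Fin 2) (ε : ℤˣ) (w : Fin 2 → ℤ) [Fact (w α = -ε)] (Z : Ser K w)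
      (hZ : HasInv0 (rowR α ε Z)) (hHZ : hopR α ε ρ • Z = 0) :
      DirectSumDecomposition α ε (hop ρ) := by
    obtain ⟨X, hX0, Y, hY0, hX, hY, hH⟩ := exists_hopR_eq (α := α) (ε := ε) h.rho_ne_zero
    exact directSumDecomposition hX0 hY0 hX hY hH hZ hHZ
  rcases Int.units_eq_one_or ε with rfl | rfl <;> fin_cases α
  · exact key 0 1 _ _ h.hasInv0_row₁ h.hopR_smul_wave₁
  · exact key 1 1 _ _ h.hasInv0_row₃' h.hopR_smul_wave₃'
  · exact key 0 (-1) _ _ h.hasInv0_row₃ h.hopR_smul_wave₃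
  · exact key 1 (-1) _ _ h.hasInv0_row₂ h.hopR_smul_wave₂

/-- An operator acts on the wave kernels as the powers of the Lax operators do, as soon as this
holds up to terms of the right orders. -/
theorem mul_wave_eq {B : FOp K} (hB : B ∈ opE K) {M₁ : Rng K 0 1} {M₂ : Rng K 1 (-1)}
    (hM₁ : M₁ • waveS w₁ 0 (u 0) (v 0) = waveS w₁ (n 0) (u 0) (v 0))
    (hM₂ : M₂ • waveS w₂ (-1) (u 1) (v 1) = waveS w₂ (n 1 - 1) (u 1) (v 1))
    (h₁ : ∀ j, (B * wave w₁ 0 (u 0) (v 0) - wave w₁ (n 0) (u 0) (v 0)) j ≠ 0 → j 0 ≤ -1)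
    (h₂ : ∀ j, (B * wave w₂ (-1) (u 1) (v 1) - wave w₂ (n 1 - 1) (u 1) (v 1)) j ≠ 0 → 1 ≤ j 1)
    (h₃ : ∀ j, (B * wave w₃ 0 (u 2) (v 2) - wave w₃ (n 2) (u 2) (v 2)) j ≠ 0 → j 1 ≤ j 0) :
    B * wave w₁ 0 (u 0) (v 0) = wave w₁ (n 0) (u 0) (v 0) ∧
    B * wave w₂ (-1) (u 1) (v 1) = wave w₂ (n 1 - 1) (u 1) (v 1) ∧
    B * wave w₃ 0 (u 2) (v 2) = wave w₃ (n 2) (u 2) (v 2) := by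
  -- `B` applied to the equation for `l = 0`, minus the equation for `l = 1`.
  have hsum : B * wave w₁ 0 (u 0) (v 0) - wave w₁ (n 0) (u 0) (v 0) =
      (B * wave w₂ (-1) (u 1) (v 1) - wave w₂ (n 1 - 1) (u 1) (v 1)) +
      (B * wave w₃ 0 (u 2) (v 2) - wave w₃ (n 2) (u 2) (v 2)) := by
    have hb := h.bilinear 1
    simp only [Nat.cast_one, mul_one] at hb
    rw [h.bilinear_zero, hb, mul_add_of_mem_opE hB]
    abel
  have hX₁ : B * wave w₁ 0 (u 0) (v 0) - wave w₁ (n 0) (u 0) (v 0) = 0 := by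
    have key : ((⟨B, opE_subset_Rng hB 0 1⟩ : Rng K 0 1) - M₁) • waveS w₁ 0 (u 0) (v 0) = 0 := by
      refine smul_waveS_eq_zero rfl _ _ (h.v_ne_zero 0) _ (rowR_eq_zero fun j hj m => ?_)
      have hj1 : j 1 = 0 := hj 1 (by decide)
      rw [sub_smul, hM₁]
      change (B * wave w₁ 0 (u 0) (v 0) - wave w₁ (n 0) (u 0) (v 0)) j m = 0
      -- At `j 1 = 0` and `j 0 < 0` neither `1 ≤ j 1` nor `j 1 ≤ j 0` holds.
      by_cases hj0 : j 0 ≤ -1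
      · rw [hsum, FOp.add_apply, apply_eq_zero_of_imp (h₂ j) (by omega),
          apply_eq_zero_of_imp (h₃ j) (by omega), add_zero]
      · exact apply_eq_zero_of_imp (h₁ j) hj0 m
    rw [sub_smul, hM₁] at key
    exact congrArg Subtype.val key
  rw [hX₁] at hsum
  have hX₂ : B * wave w₂ (-1) (u 1) (v 1) - wave w₂ (n 1 - 1) (u 1) (v 1) = 0 := by
    have key : ((⟨B, opE_subset_Rng hB 1 (-1)⟩ : Rng K 1 (-1)) - M₂) •
        waveS w₂ (-1) (u 1) (v 1) = 0 := by
      refine smul_waveS_eq_zero rfl _ _ (h.v_ne_zero 1) _ (rowR_eq_zero fun j hj m => ?_)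
      have hj0 : j 0 = 0 := hj 0 (by decide)
      rw [sub_smul, hM₂]
      change (B * wave w₂ (-1) (u 1) (v 1) - wave w₂ (n 1 - 1) (u 1) (v 1)) j m = 0
      by_cases hj1 : 1 ≤ j 1
      · rw [eq_neg_of_add_eq_zero_left hsum.symm]
        change -((B * wave w₃ 0 (u 2) (v 2) - wave w₃ (n 2) (u 2) (v 2)) j m) = 0
        rw [apply_eq_zero_of_imp (h₃ j) (by omega), neg_zero]
      · exact apply_eq_zero_of_imp (h₂ j) hj1 m
    rw [sub_smul, hM₂] at key
    exact congrArg Subtype.val key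
  rw [hX₂, zero_add] at hsum
  exact ⟨sub_eq_zero.1 hX₁, sub_eq_zero.1 hX₂, sub_eq_zero.1 hsum.symm⟩

/-- An operator without `Λ₁` whose coefficients sum to zero lowers the order of the first wave
kernel. -/
theorem mul_wave₁_ne_zero {G : FOp K} (hG : ∀ j, G j ≠ 0 → j 0 = 0)
    (hsum : ∀ m, ∑ᶠ i, G i m = 0) {j : ZLat} (hj : (G * wave w₁ 0 (u 0) (v 0)) j ≠ 0) :
    j 0 ≤ -1 := by
  obtain ⟨i, hi, hji⟩ := exists_of_mul_ne_zero hj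
  have h1 := le_of_wave₁ hji
  have c1 : (j - i) 0 = j 0 - i 0 := rfl
  have h2 := hG i hi
  by_contra! hlt
  have hj0 : j 0 = 0 := by omega
  refine hj (funext fun m => ?_)
  rw [mul_apply]
  -- Every coefficient of `W₁` of order zero in `Λ₁` is `1`, so what remains is the sum of the
  -- coefficients of `G`.
  refine Eq.trans (finsum_congr fun k => ?_) (hsum m)
  by_cases hk : G k = 0
  · rw [hk, Pi.zero_apply, zero_mul]
  · have c2 : (j - k) 0 = j 0 - k 0 := rfl
    rw [h.wave₁_apply (by rw [c2, hj0, hG k hk, sub_zero]), mul_one]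

end IsWaveData

end ThreeKP
end

noncomputable section
namespace ThreeKP

open FOp

/-! ### Action of the two Lax operators on the wave kernels -/

section Abstract

variable {K : Type} [Field K]

theorem sub_mul_of_mem {α : Fin 2} {ε : ℤˣ} {w : Fin 2 → ℤ} (hw : w α = -ε) {A B C : FOp K}
    (hA : A ∈ Rng K α ε) (hB : B ∈ Rng K α ε) (hC : C ∈ Ser K w) :
    (A - B) * C = A * C - B * C := by
  have h := add_mul_of_mem hw (AddSubgroup.sub_mem _ hA hB) hB hC
  rw [sub_add_cancel] at h
  rw [h, add_sub_cancel_right]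

theorem ne_zero_or_of_add_ne_zero {A B : FOp K} {j : ZLat} (h : (A + B) j ≠ 0) :
    A j ≠ 0 ∨ B j ≠ 0 := by
  by_contra! hc
  refine h ?_
  change A j + B j = 0
  rw [hc.1, hc.2, add_zero]

theorem nonnegPart₁_ne_zero {A : FOp K} {j : ZLat} (h : nonnegPart₁ A j ≠ 0) :
    0 ≤ j 0 ∧ A j ≠ 0 := by
  have h1 : 0 ≤ j 0 := by
    by_contra hc
    exact h (funext fun m => if_neg hc)
  exact ⟨h1, fun h0 => h (funext fun m => by rw [nonnegPart₁, if_pos h1, h0])⟩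

theorem negPart₁_ne_zero {A : FOp K} {j : ZLat} (h : negPart₁ A j ≠ 0) : j 0 < 0 ∧ A j ≠ 0 := by
  have h1 : j 0 < 0 := by
    by_contra hc
    exact h (funext fun m => if_neg hc)
  exact ⟨h1, fun h0 => h (funext fun m => by rw [negPart₁, if_pos h1, h0])⟩

theorem nonnegPart₁_sub_ne_zero {A : FOp K} {j : ZLat} (h : (nonnegPart₁ A - A) j ≠ 0) :
    j 0 < 0 := by
  by_contra! hc
  refine h (funext fun m => ?_)
  rw [FOp.sub_apply, nonnegPart₁, if_pos hc, sub_self]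
  rfl

theorem negPart₁_sub_ne_zero {A : FOp K} {j : ZLat} (h : (negPart₁ A - A) j ≠ 0) :
    0 ≤ j 0 ∧ A j ≠ 0 := by
  have h1 : 0 ≤ j 0 := by
    by_contra! hc
    refine h (funext fun m => ?_)
    rw [FOp.sub_apply, negPart₁, if_pos hc, sub_self]
    rfl
  refine ⟨h1, fun h0 => h (funext fun m => ?_)⟩
  rw [FOp.sub_apply, negPart₁, if_neg (by omega), h0, Pi.zero_apply, sub_zero]

theorem opEα0_one {α : Fin 2} {ε : ℤˣ} {A : FOp K} (hA : A ∈ opEα0 K α ε) {j : ZLat}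
    (hj : A j ≠ 0) {β : Fin 2} (hβ : β ≠ α) : j β = 0 := by
  by_contra h
  exact hj (hA.2 j ⟨β, hβ, h⟩)

theorem nonnegPart₁_mem_opE {A : FOp K} (hA : A ∈ opEα0 K 0 1) : nonnegPart₁ A ∈ opE K := by
  obtain ⟨N, hN⟩ := mem_opEα_iff.1 hA.1
  refine mem_opE_of_abs_le (N := N) fun j hj => ?_
  obtain ⟨h1, h2⟩ := nonnegPart₁_ne_zero hj
  have h3 := (hN j h2).1
  rw [Units.val_one, one_mul] at h3
  rw [opEα0_one hA h2 one_ne_zero, abs_of_nonneg h1, abs_zero]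
  omega

theorem negPart₁_mem_opE {A : FOp K} (hA : A ∈ opEα0 K 0 (-1)) : negPart₁ A ∈ opE K := by
  obtain ⟨N, hN⟩ := mem_opEα_iff.1 hA.1
  refine mem_opE_of_abs_le (N := N) fun j hj => ?_
  obtain ⟨h1, h2⟩ := negPart₁_ne_zero hj
  have h3 := (hN j h2).1
  rw [Units.val_neg, Units.val_one, neg_one_mul] at h3
  rw [opEα0_one hA h2 one_ne_zero, abs_of_neg h1, abs_zero]
  omega

namespace IsWaveData

variable {n : Fin 3 → ℕ} {u v : Fin 3 → ℕ → ZLat → K} {ρ : ZLat → K}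

/-- Here `G` stands for the third summand of either Lax operator; the hypotheses on it are the
support conditions that both versions share. -/
theorem laxOp_mul_wave (h : IsWaveData n u v ρ) {P : Rng K 0 1} {Q : Rng K 1 (-1)} {G : FOp K}
    (hP : P ∈ Rng0 K 0 1) (hQ : Q ∈ Rng0 K 1 (-1)) (hG : G ∈ opE K)
    (hPw : P • waveS w₁ 0 (u 0) (v 0) = waveS w₁ (n 0) (u 0) (v 0))
    (hQw : Q • waveS w₂ (-1) (u 1) (v 1) = waveS w₂ (n 1 - 1) (u 1) (v 1))
    (hG₁ : ∀ j, (G * wave w₁ 0 (u 0) (v 0)) j ≠ 0 → j 0 ≤ -1)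
    (hG₂ : ∀ j, G j ≠ 0 → 0 ≤ j 1)
    (hG₃ : ∀ j, (G * wave w₃ 0 (u 2) (v 2) - wave w₃ (n 2) (u 2) (v 2)) j ≠ 0 → j 1 ≤ j 0) :
    let B := nonnegPart₁ P.1 + deltaPosPart (-1) Q.1 + G
    B ∈ opE K ∧ B * wave w₁ 0 (u 0) (v 0) = wave w₁ (n 0) (u 0) (v 0) ∧
      B * wave w₂ (-1) (u 1) (v 1) = wave w₂ (n 1 - 1) (u 1) (v 1) ∧
      B * wave w₃ 0 (u 2) (v 2) = wave w₃ (n 2) (u 2) (v 2) := by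
  intro B
  have hP' := coe_mem_opEα0 hP
  have hQ' := coe_mem_opEα0 hQ
  have hB₁ := nonnegPart₁_mem_opE hP'
  have hB₂ := deltaPosPart_mem_opE hQ'
  have hB₁₂ := add_mem_opE hB₁ hB₂
  have hB : B ∈ opE K := add_mem_opE hB₁₂ hG
  have hPw' : P.1 * wave w₁ 0 (u 0) (v 0) = wave w₁ (n 0) (u 0) (v 0) := congrArg Subtype.val hPw
  have hQw' : Q.1 * wave w₂ (-1) (u 1) (v 1) = wave w₂ (n 1 - 1) (u 1) (v 1) :=
    congrArg Subtype.val hQw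
  refine ⟨hB, h.mul_wave_eq hB hPw hQw (fun j hj => ?_) (fun j hj => ?_) fun j hj => ?_⟩
  · have hw : w₁ 0 = -((1 : ℤˣ) : ℤ) := rfl
    have hS := wave_mem_Ser w₁ 0 (u 0) (v 0)
    rw [← hPw', add_mul_of_mem hw (opE_subset_Rng hB₁₂ _ _) (opE_subset_Rng hG _ _) hS,
      add_mul_of_mem hw (opE_subset_Rng hB₁ _ _) (opE_subset_Rng hB₂ _ _) hS, add_assoc,
      add_sub_right_comm, ← sub_mul_of_mem hw (opE_subset_Rng hB₁ _ _) P.2 hS] at hj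
    rcases ne_zero_or_of_add_ne_zero hj with hj | hj
    · obtain ⟨i, hi, hji⟩ := exists_of_mul_ne_zero hj
      have h1 := nonnegPart₁_sub_ne_zero hi
      have h2 := le_of_wave₁ hji
      rw [Pi.sub_apply] at h2
      omega
    · rcases ne_zero_or_of_add_ne_zero hj with hj | hj
      · exact h.mul_wave₁_ne_zero (fun j hj => (deltaPosPart_ne_zero hQ' hj).1)
          (finsum_deltaPosPart hQ') hj
      · exact hG₁ j hj
  · have hw : w₂ 1 = -((-1 : ℤˣ) : ℤ) := rfl
    -- Replacing `L₂^{n₂}` by its part of positive order in `Δ₂^*` changes only terms of nonnegative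
    -- order in `Λ₂`; so `B - Q` has none of negative order and keeps `W₂` in `1 ≤ j 1`.
    rw [← hQw', ← sub_mul_of_mem hw (opE_subset_Rng hB _ _) Q.2 (wave_mem_Ser w₂ (-1) (u 1) (v 1)),
      show B - Q.1 = nonnegPart₁ P.1 + -(Q.1 - deltaPosPart (-1) Q.1) + G by
        change _ + _ + _ - _ = _; abel] at hj
    obtain ⟨i, hi, hji⟩ := exists_of_mul_ne_zero hj
    have h2 := le_of_wave₂ hji
    rw [Pi.sub_apply] at h2
    have h3 : 0 ≤ i 1 := by
      rcases ne_zero_or_of_add_ne_zero hi with hi | hi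
      · rcases ne_zero_or_of_add_ne_zero hi with hi | hi
        · exact (opEα0_one hP' (nonnegPart₁_ne_zero hi).2 one_ne_zero).ge
        · have h4 := (sub_deltaPosPart_ne_zero hQ' (j := i) fun h0 => hi (by
            change -((Q.1 - deltaPosPart (-1) Q.1) i) = 0
            rw [h0, neg_zero])).2
          rw [Units.val_neg, Units.val_one] at h4
          omega
      · exact hG₂ i hi
    omega
  · have hw : w₃ 0 = -((-1 : ℤˣ) : ℤ) := rfl
    have hS := wave_mem_Ser w₃ 0 (u 2) (v 2)
    rw [add_mul_of_mem hw (opE_subset_Rng hB₁₂ _ _) (opE_subset_Rng hG _ _) hS,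
      add_sub_assoc] at hj
    rcases ne_zero_or_of_add_ne_zero hj with hj | hj
    · obtain ⟨i, hi, hji⟩ := exists_of_mul_ne_zero hj
      have h2 := le_of_wave₃ hji
      rw [Pi.sub_apply, Pi.sub_apply] at h2
      have h3 : i 1 ≤ i 0 := by
        -- The first two summands have only nonnegative powers of `Λ₁`, respectively nonpositive
        -- powers of `Λ₂`, and both kinds preserve `j 1 ≤ j 0`.
        rcases ne_zero_or_of_add_ne_zero hi with hi | hi
        · obtain ⟨h4, h5⟩ := nonnegPart₁_ne_zero hi
          rwa [opEα0_one hP' h5 one_ne_zero]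
        · obtain ⟨h4, h5⟩ := deltaPosPart_ne_zero hQ' hi
          rw [Units.val_neg, Units.val_one] at h5
          omega
      omega
    · exact hG₃ j hj

theorem proj_hop_eq (h : IsWaveData n u v ρ) {α : Fin 2} {ε : ℤˣ} {w : Fin 2 → ℤ}
    [Fact (w α = -ε)] {Z : Ser K w} (hZ : HasInv0 (rowR α ε Z)) (hHZ : hopR α ε ρ • Z = 0)
    {B : FOp K} (hB : B ∈ opE K) {P : Rng K α ε} (hP : P ∈ Rng0 K α ε)
    (hBP : B * Z.1 = (P • Z).1) : proj α ε (hop ρ) B = P :=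
  proj_eq (H := hopR α ε ρ) (h.directSumDecomposition_hop α ε) hZ hHZ
    (A := ⟨B, opE_subset_Rng hB α ε⟩) hP (Subtype.ext hBP)

theorem main (h : IsWaveData n u v ρ) :
    let B₁ := nonnegPart₁ (lax 0 1 (u 0) ^ n 0)
    let B₂ := deltaPosPart (-1) (lax 1 (-1) (u 1) ^ n 1)
    let B₃ := negPart₁ (lax 0 (-1) (u 2) ^ n 2)
    let B₃' := deltaPosPart 1 (lax 1 1 (u 2) ^ n 2)
    ∀ B, B = B₁ + B₂ + B₃ ∨ B = B₁ + B₂ + B₃' → B ∈ opE K ∧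
      proj 0 1 (hop ρ) B = lax 0 1 (u 0) ^ n 0 ∧
      proj 0 (-1) (hop ρ) B = lax 0 (-1) (u 2) ^ n 2 ∧
      proj 1 1 (hop ρ) B = lax 1 1 (u 2) ^ n 2 ∧
      proj 1 (-1) (hop ρ) B = lax 1 (-1) (u 1) ^ n 1 := by
  obtain ⟨M₁, hM₁, e1, a1⟩ := exists_lax_eq (α := 0) (ε := 1) (h.u_ne_zero 0)
  obtain ⟨M₂, hM₂, e2, a2⟩ := exists_lax_eq (α := 1) (ε := -1) (h.u_ne_zero 1)
  obtain ⟨M₃, hM₃, e3, a3⟩ := exists_lax_eq (α := 0) (ε := -1) (h.u_ne_zero 2)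
  obtain ⟨M₄, hM₄, e4, a4⟩ := exists_lax_eq (α := 1) (ε := 1) (h.u_ne_zero 2)
  rw [← e1, ← e2, ← e3, ← e4, ← coe_pow, ← coe_pow, ← coe_pow, ← coe_pow]
  intro B₁ B₂ B₃ B₃' B hB
  have p1 := a1 w₁ (n 0) 0 (v 0)
  have p2 := a2 w₂ (n 1) (-1) (v 1)
  have p3 := a3 w₃ (n 2) 0 (v 2)
  have p4 := a4 w₃ (n 2) 0 (v 2)
  rw [zero_add] at p1 p3 p4
  rw [neg_add_eq_sub] at p2
  have q1 := pow_mem hM₁ (n 0)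
  have q2 := pow_mem hM₂ (n 1)
  have q3 := pow_mem hM₃ (n 2)
  have q4 := pow_mem hM₄ (n 2)
  have q3' := coe_mem_opEα0 q3
  have q4' := coe_mem_opEα0 q4
  have hS := wave_mem_Ser w₃ 0 (u 2) (v 2)
  have key : B ∈ opE K ∧ B * wave w₁ 0 (u 0) (v 0) = wave w₁ (n 0) (u 0) (v 0) ∧
      B * wave w₂ (-1) (u 1) (v 1) = wave w₂ (n 1 - 1) (u 1) (v 1) ∧
      B * wave w₃ 0 (u 2) (v 2) = wave w₃ (n 2) (u 2) (v 2) := by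
    rcases hB with rfl | rfl
    · have hG := negPart₁_mem_opE q3'
      refine h.laxOp_mul_wave q1 q2 hG p1 p2 (fun j hj => ?_) (fun j hj => ?_) fun j hj => ?_
      · obtain ⟨i, hi, hji⟩ := exists_of_mul_ne_zero hj
        have h1 := (negPart₁_ne_zero hi).1
        have h2 := le_of_wave₁ hji
        rw [Pi.sub_apply] at h2
        omega
      · exact (opEα0_one q3' (negPart₁_ne_zero hj).2 one_ne_zero).ge
      · have p3' : (M₃ ^ n 2).1 * wave w₃ 0 (u 2) (v 2) = wave w₃ (n 2) (u 2) (v 2) :=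
          congrArg Subtype.val p3
        rw [← p3', ← sub_mul_of_mem (α := 0) (ε := -1) rfl (opE_subset_Rng hG _ _)
          (M₃ ^ n 2).2 hS] at hj
        obtain ⟨i, hi, hji⟩ := exists_of_mul_ne_zero hj
        obtain ⟨h1, h2⟩ := negPart₁_sub_ne_zero hi
        have h3 := opEα0_one q3' h2 one_ne_zero
        have h4 := le_of_wave₃ hji
        rw [Pi.sub_apply, Pi.sub_apply] at h4
        omega
    · have hG := deltaPosPart_mem_opE q4'
      refine h.laxOp_mul_wave q1 q2 hG p1 p2 (fun j hj => ?_) (fun j hj => ?_) fun j hj => ?_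
      · exact h.mul_wave₁_ne_zero (fun j hj => (deltaPosPart_ne_zero q4' hj).1)
          (finsum_deltaPosPart q4') hj
      · have h1 := (deltaPosPart_ne_zero q4' hj).2
        rwa [Units.val_one, one_mul] at h1
      · have p4' : (M₄ ^ n 2).1 * wave w₃ 0 (u 2) (v 2) = wave w₃ (n 2) (u 2) (v 2) :=
          congrArg Subtype.val p4
        rw [← p4', ← sub_mul_of_mem (α := 1) (ε := 1) rfl (opE_subset_Rng hG _ _)
          (M₄ ^ n 2).2 hS] at hj
        obtain ⟨i, hi, hji⟩ := exists_of_mul_ne_zero hj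
        obtain ⟨h1, h2⟩ := sub_deltaPosPart_ne_zero q4' (j := i) fun h0 => hi (by
          rw [← neg_sub]
          change -(((M₄ ^ n 2).1 - deltaPosPart 1 (M₄ ^ n 2).1) i) = 0
          rw [h0, neg_zero])
        rw [Units.val_one, one_mul] at h2
        have h4 := le_of_wave₃ hji
        rw [Pi.sub_apply, Pi.sub_apply] at h4
        omega
  obtain ⟨hBE, k1, k2, k3⟩ := key
  refine ⟨hBE, ?_, ?_, ?_, ?_⟩
  · exact h.proj_hop_eq h.hasInv0_row₁ h.hopR_smul_wave₁ hBE q1 (by rw [p1]; exact k1)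
  · exact h.proj_hop_eq h.hasInv0_row₃ h.hopR_smul_wave₃ hBE q3 (by rw [p3]; exact k3)
  · exact h.proj_hop_eq h.hasInv0_row₃' h.hopR_smul_wave₃' hBE q4 (by rw [p4]; exact k3)
  · exact h.proj_hop_eq h.hasInv0_row₂ h.hopR_smul_wave₂ hBE q2 (by rw [p2]; exact k2)

end IsWaveData

end Abstract

/-! ### Tau functions -/

/-- The coefficient of `w^k` in `f(t + [w]_i) / τ_m(t)`. -/
def dualCoeff (τ : ZLat → TSeries) (i : Fin 3) (f : TSeries) (m : ZLat) (k : ℕ) : TField :=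
  algebraMap TSeries TField (PowerSeries.coeff k (miwa i 1 f)) /
    algebraMap TSeries TField (τ m)

/-- The coefficients of the wave operators. -/
def waveData (τ : ZLat → TSeries) : Fin 3 → ℕ → ZLat → TField :=
  ![fun k m => waveCoeff τ 0 (τ m) m k, fun k m => waveCoeff τ 1 (τ (m + e₁₂)) m k, s₃ τ]

/-- The coefficients of the dual wave operators. -/
def dualData (τ : ZLat → TSeries) : Fin 3 → ℕ → ZLat → TField :=
  ![fun k m => dualCoeff τ 0 (τ m) m k, fun k m => dualCoeff τ 1 (τ (m - e₁₂)) m k,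
    fun k m => (-1) ^ (m 1) * dualCoeff τ 2 (τ (m - e₁)) m k]

theorem convol_div (U V : ℕ → TSeries) (a b x y : TField) (N : ℤ) :
    convol (fun p => a * (algebraMap TSeries TField (U p) / x))
      (fun q => b * (algebraMap TSeries TField (V q) / y)) N =
      a * b * (algebraMap TSeries TField (convol U V N) / (x * y)) := by
  unfold convol
  split_ifs
  · rw [map_sum, Finset.sum_div, Finset.mul_sum]
    refine Finset.sum_congr rfl fun p _ => ?_
    rw [map_mul]
    ring
  · simp

theorem algebraMap_neg_one_zpow_smul (k : ℤ) (f : TSeries) :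
    algebraMap TSeries TField (((-1 : ℂ) ^ k) • f) = (-1) ^ k * algebraMap TSeries TField f := by
  rcases Int.even_or_odd k with hk | hk
  · rw [hk.neg_one_zpow, hk.neg_one_zpow, one_smul, one_mul]
  · rw [hk.neg_one_zpow, hk.neg_one_zpow, neg_one_smul, map_neg, neg_one_mul]

theorem waveData_bilinear {n : Fin 3 → ℕ} {τ : ZLat → TSeries} (hτ : IsKdVTau n τ) (l : ℕ) :
    wave w₁ (n 0 * l) (waveData τ 0) (dualData τ 0) =
      wave w₂ (n 1 * l - 1) (waveData τ 1) (dualData τ 1) +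
      wave w₃ (n 2 * l) (waveData τ 2) (dualData τ 2) := by
  refine ext' fun j m => ?_
  -- The shift by `e₁` cancels the `+ 1` of the residue in the first and third exponents. It does
  -- not affect the second, whence the offset `-1` there.
  set m' : ZLat := m + e₁ + j with hm'
  have c0 : m' 0 = m 0 + 1 + j 0 := rfl
  have c1 : m' 1 = m 1 + j 1 := by
    rw [hm']
    change m 1 + 0 + j 1 = _
    rw [add_zero]
  have h := congrArg (fun F => algebraMap TSeries TField (diag F)) (hτ l m m')
  simp only [map_add, map_smul, diag_residue, algebraMap_neg_one_zpow_smul] at h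
  set x := algebraMap TSeries TField (τ m)
  set y := algebraMap TSeries TField (τ m')
  have r1 := convol_div (fun p => PowerSeries.coeff p (miwa 0 (-1) (τ m)))
    (fun q => PowerSeries.coeff q (miwa 0 1 (τ m'))) 1 1 x y (n 0 * l + deg w₁ j)
  have r2 := convol_div (fun p => PowerSeries.coeff p (miwa 1 (-1) (τ (m + e₁₂))))
    (fun q => PowerSeries.coeff q (miwa 1 1 (τ (m' - e₁₂)))) 1 1 x y (n 1 * l - 1 + deg w₂ j)
  have r3 := convol_div (fun p => PowerSeries.coeff p (miwa 2 (-1) (τ (m + e₁))))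
    (fun q => PowerSeries.coeff q (miwa 2 1 (τ (m' - e₁)))) ((-1) ^ (m 1)) ((-1) ^ (m' 1)) x y
      (n 2 * l + deg w₃ j)
  rw [← zpow_add₀ (neg_ne_zero.2 one_ne_zero)] at r3
  simp only [one_mul] at r1 r2
  rw [deg_w₁] at r1
  rw [deg_w₂] at r2
  rw [deg_w₃] at r3
  rw [FOp.add_apply]
  change convol (fun p => waveCoeff τ 0 (τ m) m p) (fun q => dualCoeff τ 0 (τ m') m' q) _ =
    convol (fun p => waveCoeff τ 1 (τ (m + e₁₂)) m p)
      (fun q => dualCoeff τ 1 (τ (m' - e₁₂)) m' q) _ +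
    convol (fun p => (-1) ^ (m 1) * waveCoeff τ 2 (τ (m + e₁)) m p)
      (fun q => (-1) ^ (m' 1) * dualCoeff τ 2 (τ (m' - e₁)) m' q) _
  rw [deg_w₁, deg_w₂, deg_w₃]
  refine r1.trans (Eq.trans ?_ (congrArg₂ (· + ·) r2 r3).symm)
  simp only [Units.val_one, Units.val_neg, one_mul] at h
  rw [show (n 0 * l + m 0 - m' 0 + 1 : ℤ) = n 0 * l + -j 0 by rw [c0]; ring,
    show -1 * (-(n 1 * l) + m 1 - m' 1 + 1 : ℤ) = n 1 * l - 1 + j 1 by rw [c1]; ring,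
    show -1 * (-(n 2 * l) + m 0 - m 1 - m' 0 + m' 1 + 1 : ℤ) = n 2 * l + (j 0 - j 1) by
      rw [c0, c1]; ring] at h
  rw [h]
  ring

theorem isWaveData {n : Fin 3 → ℕ} {τ : ZLat → TSeries} (hτ₀ : ∀ m, τ m ≠ 0)
    (hτ : IsKdVTau n τ) : IsWaveData n (waveData τ) (dualData τ) (rho τ) := by
  have ha (m : ZLat) : algebraMap TSeries TField (τ m) ≠ 0 :=
    (map_ne_zero_iff _ (IsFractionRing.injective TSeries TField)).2 (hτ₀ m)
  have hs (k : ℤ) : (-1 : TField) ^ k ≠ 0 := zpow_ne_zero _ (neg_ne_zero.2 one_ne_zero)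
  have hu0 (m : ZLat) : waveData τ 0 0 m = 1 := by
    change waveCoeff τ 0 (τ m) m 0 = 1
    rw [waveCoeff, coeff_zero_miwa, div_self (ha m)]
  have hu1 (m : ZLat) : waveData τ 1 0 m =
      algebraMap TSeries TField (τ (m + e₁₂)) / algebraMap TSeries TField (τ m) := by
    change waveCoeff τ 1 (τ (m + e₁₂)) m 0 = _
    rw [waveCoeff, coeff_zero_miwa]
  have hu2 (m : ZLat) : waveData τ 2 0 m = (-1) ^ (m 1) *
      (algebraMap TSeries TField (τ (m + e₁)) / algebraMap TSeries TField (τ m)) := by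
    change s₃ τ 0 m = _
    rw [s₃, waveCoeff, coeff_zero_miwa]
  have hv0 (m : ZLat) : dualData τ 0 0 m = 1 := by
    change dualCoeff τ 0 (τ m) m 0 = 1
    rw [dualCoeff, coeff_zero_miwa, div_self (ha m)]
  have hv1 (m : ZLat) : dualData τ 1 0 m =
      algebraMap TSeries TField (τ (m - e₁₂)) / algebraMap TSeries TField (τ m) := by
    change dualCoeff τ 1 (τ (m - e₁₂)) m 0 = _
    rw [dualCoeff, coeff_zero_miwa]
  have hv2 (m : ZLat) : dualData τ 2 0 m = (-1) ^ (m 1) *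
      (algebraMap TSeries TField (τ (m - e₁)) / algebraMap TSeries TField (τ m)) := by
    change (-1) ^ (m 1) * dualCoeff τ 2 (τ (m - e₁)) m 0 = _
    rw [dualCoeff, coeff_zero_miwa]
  refine ⟨waveData_bilinear hτ, hu0, hv0, fun i m => ?_, fun i m => ?_, fun m => ?_, fun m => ?_⟩
  · fin_cases i
    · exact (hu0 m).trans_ne one_ne_zero
    · exact (hu1 m).trans_ne (div_ne_zero (ha _) (ha _))
    · exact (hu2 m).trans_ne (mul_ne_zero (hs _) (div_ne_zero (ha _) (ha _)))
  · fin_cases i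
    · exact (hv0 m).trans_ne one_ne_zero
    · exact (hv1 m).trans_ne (div_ne_zero (ha _) (ha _))
    · exact (hv2 m).trans_ne (mul_ne_zero (hs _) (div_ne_zero (ha _) (ha _)))
  · have c : (m + e₁) 1 = m 1 := add_zero _
    rw [hv2, hu2, mul_inv, inv_div, add_sub_cancel_right, c]
    congr 1
    rcases Int.even_or_odd (m 1) with hk | hk
    · rw [hk.neg_one_zpow, inv_one]
    · rw [hk.neg_one_zpow, inv_neg_one]
  -- Adding `e` flips the parity of `m₂`, which gives the minus sign in the formula for `ρ`.
  · have c : (m + e₁₂) 1 = m 1 + 1 := rfl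
    rw [hu2, hu2, rho, c, zpow_add₀ (neg_ne_zero.2 one_ne_zero), zpow_one]
    have h1 := ha m
    have h2 := ha (m + e₁)
    have h3 := ha (m + e₁₂)
    have h4 := hs (m 1)
    field_simp

/-! ### The four Lax operators as cases of one construction -/

theorem L₁_eq (τ : ZLat → TSeries) : L₁ τ = lax 0 1 (waveData τ 0) := by
  have h : S₁ τ = ser 0 1 (waveData τ 0) := ext' fun j m => by
    simp only [S₁, ser, forall_ne_zero_iff, Units.val_one, one_mul, neg_nonneg]
    rfl
  rw [L₁, lax, h, dir_zero_one, neg_neg]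

theorem L₂_eq (τ : ZLat → TSeries) : L₂ τ = lax 1 (-1) (waveData τ 1) := by
  have h : S₂ τ = ser 1 (-1) (waveData τ 1) := ext' fun j m => by
    simp only [S₂, ser, forall_ne_one_iff, Units.val_neg, Units.val_one, neg_mul, one_mul, neg_neg,
      and_comm]
    rfl
  rw [L₂, lax, h, dir_one_neg]

theorem L₃_eq (τ : ZLat → TSeries) : L₃ τ = lax 0 (-1) (waveData τ 2) := by
  have h : S₃ τ = ser 0 (-1) (waveData τ 2) := ext' fun j m => by
    simp only [S₃, ser, forall_ne_zero_iff, Units.val_neg, Units.val_one, neg_mul, one_mul, neg_neg]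
    rfl
  rw [L₃, lax, h, dir_zero_neg]

theorem L₃'_eq (τ : ZLat → TSeries) : L₃' τ = lax 1 1 (waveData τ 2) := by
  have h : S₃' τ = ser 1 1 (waveData τ 2) := ext' fun j m => by
    simp only [S₃', ser, forall_ne_one_iff, Units.val_one, one_mul, neg_nonneg, and_comm]
    rfl
  rw [L₃', lax, h, dir_one_one, neg_neg]

end ThreeKP
end

open ThreeKP
theorem mainTheorem12 (n : Fin 3 → ℕ) (τ : ZLat → TSeries) (hτ₀ : ∀ m, τ m ≠ 0)
    (hτ : IsKdVTau n τ) :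
    (∀ (α : Fin 2) (ε : ℤˣ), DirectSumDecomposition α ε (H τ)) ∧
    (laxOp τ n ∈ opE TField ∧ laxOp' τ n ∈ opE TField) ∧
    (proj 0 1 (H τ) (laxOp τ n) = L₁ τ ^ n 0 ∧ proj 0 1 (H τ) (laxOp' τ n) = L₁ τ ^ n 0) ∧
    (proj 0 (-1) (H τ) (laxOp τ n) = L₃ τ ^ n 2 ∧
      proj 0 (-1) (H τ) (laxOp' τ n) = L₃ τ ^ n 2) ∧
    (proj 1 1 (H τ) (laxOp τ n) = L₃' τ ^ n 2 ∧ proj 1 1 (H τ) (laxOp' τ n) = L₃' τ ^ n 2) ∧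
    (proj 1 (-1) (H τ) (laxOp τ n) = L₂ τ ^ n 1 ∧
      proj 1 (-1) (H τ) (laxOp' τ n) = L₂ τ ^ n 1) := by
  have hw := isWaveData hτ₀ hτ
  have hm := hw.main
  rw [← L₁_eq, ← L₂_eq, ← L₃_eq, ← L₃'_eq] at hm
  obtain ⟨a, a1, a2, a3, a4⟩ := hm (laxOp τ n) (Or.inl rfl)
  obtain ⟨b, b1, b2, b3, b4⟩ := hm (laxOp' τ n) (Or.inr rfl)
  exact ⟨hw.directSumDecomposition_hop, ⟨a, b⟩, ⟨a1, b1⟩, ⟨a2, b2⟩, ⟨a3, b3⟩, a4, b4⟩
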